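/- Let $d\in\mathbb N$ and $p\in(1,\infty)$. Let $\mathcal P_p=\mathcal P_p(\mathbb R^d_x\times\mathbb R^d_v)$ be the set of Borel probability measures $f$ on $\mathbb R^d_x\times\mathbb R^d_v$ with $\int(|x|^p+|v|^p)\,df<\infty$, with the Wasserstein distance $W_p(f,f')^p=\inf_\Gamma\int(|x-x'|^p+|v-v'|^p)\,d\Gamma$, the infimum being over all couplings $\Gamma$ of $f$ and $f'$; write $\langle f,\varphi\rangle=\int\varphi\,df$. For constants $c,C>0$ consider functionals $\Phi:\mathcal P_p\to\mathbb R$ such that (A1) $\langle f,-C+c|v|^p\rangle\le\Phi(f)\le\langle f,C+C|v|^p\rangle$ for all $f\in\mathcal P_p$, (A2) $|\Phi(f)-\Phi(f')|\le\langle f+f',C+C|v|^p\rangle^{(p-1)/p}\,W_p(f,f')$ for all $f,f'\in\mathcal P_p$. A Markov kernel $\pi:\mathbb R^d_x\times\mathbb R^d_v\to\mathcal P_p(\mathbb R^d_v)$ acts on measures by $f\pi(dx,dv)=\int f(dx,dv')\,\pi(x,v',dv)$; it is a martingale kernel if $\int v'\,\pi(x,v,dv')=v$ for all $(x,v)$.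 The relaxation of $\Phi$ is $$\Phi^{\mathrm{rel}}(f)=\inf\Big\{\sum_{i=1}^N\lambda_i\Phi(f\pi_i)\Big\},$$ the infimum being over all $N$, all $\lambda_i\in[0,1]$ with $\sum_i\lambda_i=1$, and all Markov kernels $\pi_i:\mathbb R^d_x\times\mathbb R^d_v\to\mathcal P_p(\mathbb R^d_v)$ with $f\pi_i\in\mathcal P_p$ such that $\sum_i\lambda_i\pi_i$ is a martingale kernel. For $f,g\in\mathcal P_p$ write $g\succeq f$ if $\langle g,\varphi\rangle\ge\langle f,\varphi\rangle$ for every continuous $\varphi$ that is convex in $v$ and satisfies $|\varphi(x,v)|\le K(1+|x|+|v|)^p$ for some $K$. A functional $\Psi:\mathcal P_p\to\mathbb R$ is increasing if $g\succeq f$ implies $\Psi(g)\ge\Psi(f)$, and convex if $\Psi((1-t)f+tg)\le(1-t)\Psi(f)+t\Psi(g)$ for all $f,g\in\mathcal P_p$, $t\in[0,1]$. Let $\Psi^{\mathrm{inc}}(f)=\inf\{\Psi(g):g\succeq f\}$, and let $\Psi^{\mathrm{conv}}$ be the convex envelope of $\Psi$, the pointwise supremum of all convex functionals $\le\Psi$.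 Then for all $d,p,c,C$ as above there is a constant $C'$ with $C'>c$ and $C'\ge C$ such that every $\Phi$ satisfying (A1) and (A2) with the constants $c,C$ has the following properties. 1. $\langle f,-C+c|v|^p\rangle\le\Phi^{\mathrm{rel}}(f)\le\langle f,C+C|v|^p\rangle$ for all $f\in\mathcal P_p$ (hence also with $C'$ in place of $C$). 2. $\Phi^{\mathrm{rel}}$ is $W_p$-continuous, and $|\Phi^{\mathrm{rel}}(f)-\Phi^{\mathrm{rel}}(f')|\le\langle f+f',C'+C'|v|^p\rangle^{(p-1)/p}\,W_p(f,f')$ for all $f,f'\in\mathcal P_p$. 3. $\Phi^{\mathrm{rel}}$ is increasing. 4. $(\Phi^{\mathrm{conv}})^{\mathrm{inc}}\le(\Phi^{\mathrm{inc}})^{\mathrm{conv}}$ and $(\Phi^{\mathrm{conv}})^{\mathrm{inc}}\le\Phi^{\mathrm{rel}}\le\Phi^{\mathrm{inc}}$. If $\Phi$ is convex, then $\Phi^{\mathrm{rel}}=\Phi^{\mathrm{inc}}$ and $\Phi^{\mathrm{rel}}$ is convex. -/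

import Mathlib

open MeasureTheory ProbabilityTheory
open scoped ENNReal

namespace RelaxedAction

noncomputable section

/-- The space `ℝ^d` with its Euclidean norm (used both for positions and for velocities). -/
abbrev Vec (d : ℕ) : Type := EuclideanSpace ℝ (Fin d)

/-- The position-velocity space `ℝ^d_x × ℝ^d_v`. -/
abbrev Phase (d : ℕ) : Type := Vec d × Vec d

/-- `𝒫_p(ℝ^d_x × ℝ^d_v)`: Borel probability measures with finite moment of order `p`. -/
def PP (d : ℕ) (p : ℝ) : Type :=
  {f : Measure (Phase d) //
    IsProbabilityMeasure f ∧ Integrable (fun z : Phase d => ‖z.1‖ ^ p + ‖z.2‖ ^ p) f}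

/-- The convex combination `(1 - t) f + t g` of two elements of `𝒫_p`, for `t ∈ [0,1]`. -/
def mix {d : ℕ} {p : ℝ} (t : ℝ) (ht : t ∈ Set.Icc (0 : ℝ) 1) (f g : PP d p) : PP d p :=
  ⟨ENNReal.ofReal (1 - t) • f.1 + ENNReal.ofReal t • g.1, by
    constructor
    · constructor
      have := f.2.1
      have := g.2.1
      simp only [Measure.coe_add, Measure.coe_smul, Pi.add_apply, Pi.smul_apply, measure_univ,
        smul_eq_mul, mul_one]
      rw [← ENNReal.ofReal_add (by linarith [ht.2]) ht.1]
      simp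
    · exact (f.2.2.smul_measure ENNReal.ofReal_ne_top).add_measure
        (g.2.2.smul_measure ENNReal.ofReal_ne_top)⟩

/-- The couplings of `f` and `g`. -/
def couplings {d : ℕ} {p : ℝ} (f g : PP d p) : Set (Measure (Phase d × Phase d)) :=
  {Γ | Γ.map Prod.fst = f.1 ∧ Γ.map Prod.snd = g.1}

/-- The `p`-Wasserstein distance,
`W_p(f,g)^p = inf_Γ ∫ (|x - x'|^p + |v - v'|^p) dΓ` over all couplings `Γ` of `f` and `g`. -/
def Wp {d : ℕ} {p : ℝ} (f g : PP d p) : ℝ :=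
  (⨅ Γ ∈ couplings f g,
    ∫⁻ q, ENNReal.ofReal (‖q.1.1 - q.2.1‖ ^ p + ‖q.1.2 - q.2.2‖ ^ p) ∂Γ).toReal ^ (1 / p)

/-- `⟨f, a + b |v|^p⟩`. -/
def pairing {d : ℕ} {p : ℝ} (f : PP d p) (a b : ℝ) : ℝ :=
  ∫ z : Phase d, (a + b * ‖z.2‖ ^ p) ∂f.1

/-- The growth condition `⟨f, -C + c|v|^p⟩ ≤ Φ(f) ≤ ⟨f, C + C|v|^p⟩`. -/
def Growth {d : ℕ} {p : ℝ} (c C : ℝ) (Φ : PP d p → ℝ) : Prop :=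
  ∀ f, pairing f (-C) c ≤ Φ f ∧ Φ f ≤ pairing f C C

/-- The estimate `|Φ(f) - Φ(f')| ≤ ⟨f + f', C + C|v|^p⟩^((p-1)/p) W_p(f,f')`. -/
def WpEstimate {d : ℕ} {p : ℝ} (C : ℝ) (Φ : PP d p → ℝ) : Prop :=
  ∀ f f', |Φ f - Φ f'| ≤ (pairing f C C + pairing f' C C) ^ ((p - 1) / p) * Wp f f'

/-- Continuity with respect to `W_p`. -/
def WpContinuous {d : ℕ} {p : ℝ} (Φ : PP d p → ℝ) : Prop :=
  ∀ f, ∀ ε > 0, ∃ δ > 0, ∀ f', Wp f f' < δ → |Φ f' - Φ f| < ε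

/-- `π` is a Markov kernel `ℝ^d_x × ℝ^d_v → 𝒫_p(ℝ^d_v)`. -/
def IsPKernel {d : ℕ} (p : ℝ) (π : Kernel (Phase d) (Vec d)) : Prop :=
  IsMarkovKernel π ∧ ∀ z, Integrable (fun w : Vec d => ‖w‖ ^ p) (π z)

/-- `π ∈ MK_p`: a Markov kernel with values in `𝒫_p(ℝ^d_v)` such that
`∫ v' π(x,v,dv') = v` for all `(x,v)`. -/
def IsMartingaleKernel {d : ℕ} (p : ℝ) (π : Kernel (Phase d) (Vec d)) : Prop :=
  IsPKernel p π ∧ ∀ z : Phase d, ∫ w, w ∂(π z) = z.2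

/-- The kernel `∑ i, l i • π i`. -/
def combine {d N : ℕ} (l : Fin N → ℝ) (π : Fin N → Kernel (Phase d) (Vec d)) :
    Kernel (Phase d) (Vec d) where
  toFun z := ∑ i, ENNReal.ofReal (l i) • π i z
  measurable' := by
    refine Measure.measurable_of_measurable_coe _ fun s hs => ?_
    simp only [Measure.coe_finsetSum, Finset.sum_apply, Measure.smul_apply, smul_eq_mul]
    exact Finset.measurable_sum _ fun i _ => ((π i).measurable_coe hs).const_mul _

/-- The measure `fπ(dx,dv) = ∫ f(dx,dv') π(x,v',dv)`. -/
def applyKernel {d : ℕ} (f : Measure (Phase d)) (π : Kernel (Phase d) (Vec d)) :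
    Measure (Phase d) :=
  (f ⊗ₘ π).map (fun q : Phase d × Vec d => (q.1.1, q.2))

/-- The set of values `∑ i, l i * Φ(f π_i)` over all finite families of weights `l i ∈ [0,1]` with
sum one and Markov kernels `π_i` with values in `𝒫_p(ℝ^d_v)` such that `∑ i, l i • π_i` is a
martingale kernel; the measures `g i = f π_i` have to lie in the domain `𝒫_p` of `Φ`. -/
def relaxationValues {d : ℕ} {p : ℝ} (Φ : PP d p → ℝ) (f : PP d p) : Set ℝ :=
  {a | ∃ (N : ℕ) (l : Fin N → ℝ) (π : Fin N → Kernel (Phase d) (Vec d)) (g : Fin N → PP d p),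
    (∀ i, l i ∈ Set.Icc (0 : ℝ) 1) ∧ ∑ i, l i = 1 ∧ (∀ i, IsPKernel p (π i)) ∧
    IsMartingaleKernel p (combine l π) ∧ (∀ i, (g i).1 = applyKernel f.1 (π i)) ∧
    a = ∑ i, l i * Φ (g i)}

/-- The relaxation `Φ^rel`. (Under the growth condition the set is bounded below by `-C`, and the
kernel `δ_v` shows that it is nonempty.) -/
def rel {d : ℕ} {p : ℝ} (Φ : PP d p → ℝ) (f : PP d p) : ℝ :=
  sInf (relaxationValues Φ f)

/-- The velocity-convex order `f ≼ g`: `⟨f, φ⟩ ≤ ⟨g, φ⟩` for all continuous `φ` that are convex in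
`v` and satisfy `|φ(x,v)| ≤ K (1 + |x| + |v|)^p` for some `K`. -/
def VConvexLE {d : ℕ} {p : ℝ} (f g : PP d p) : Prop :=
  ∀ φ : Phase d → ℝ, Continuous φ →
    (∀ x, ConvexOn ℝ Set.univ (fun v => φ (x, v))) →
    (∃ K : ℝ, ∀ x v, |φ (x, v)| ≤ K * (1 + ‖x‖ + ‖v‖) ^ p) →
    ∫ z, φ z ∂f.1 ≤ ∫ z, φ z ∂g.1

/-- `Φ` is increasing in the velocity-convex order. -/
def Increasing {d : ℕ} {p : ℝ} (Φ : PP d p → ℝ) : Prop :=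
  ∀ f g, VConvexLE f g → Φ f ≤ Φ g

/-- `Φ` is convex with respect to linear interpolation of measures. -/
def IsConvex {d : ℕ} {p : ℝ} (Φ : PP d p → ℝ) : Prop :=
  ∀ (f g : PP d p) (t : ℝ) (ht : t ∈ Set.Icc (0 : ℝ) 1),
    Φ (mix t ht f g) ≤ (1 - t) * Φ f + t * Φ g

/-- The increasing envelope `Φ^inc(f) = inf {Φ(g) : g ≽ f}`. -/
def inc {d : ℕ} {p : ℝ} (Φ : PP d p → ℝ) (f : PP d p) : ℝ :=
  sInf {a | ∃ g, VConvexLE f g ∧ a = Φ g}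

/-- The convex envelope `Φ^conv`: the pointwise supremum of all convex functionals below `Φ`. -/
def conv {d : ℕ} {p : ℝ} (Φ : PP d p → ℝ) (f : PP d p) : ℝ :=
  sSup {a | ∃ Ψ : PP d p → ℝ, IsConvex Ψ ∧ (∀ g, Ψ g ≤ Φ g) ∧ a = Ψ f}

end

end RelaxedAction

open RelaxedAction

/-!
The relaxation is defined by martingale kernels, the velocity-convex order by test functions. The
two are linked by an approximate version of Strassen's theorem, and the remaining assertions follow
from constructions with couplings.

*Transport of competitors.* Let `P` be a coupling of `f` and `g`, with `(z, z')` distributed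
according to `P`, and let `s` be a random shift such that `v' + s` has conditional expectation `v`
given `z = (x, v)`. Given competitor kernels `π i` for `g`, draw `w` from `π i z'` and take the law
of `(z, w + s)`. After disintegration this is a competitor for `f` (`rel_le_of_jointLaws`), and its
distance to the competitor for `g` is at most `(E |x - x'| ^ p + E |s| ^ p) ^ (1 / p)`. The growth
condition bounds the moments of almost optimal competitors, so the estimate for `Φ` bounds
`rel Φ f - rel Φ g` (`rel_le_rel_add_of_shift`). The shift `s = v - v'` is admissible for every
coupling and gives the `W_p`-estimate for `rel Φ`.

*Monotonicity.* Suppose that `f ≼ g`. It suffices to find couplings of `f` and `g` with an admissible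
shift and arbitrarily small `E |x - x'| ^ p + E |s| ^ p` (`VConvexLE.exists_coupling`). Let `χ k` be a
finite partition of unity on `ℝ^d` with small supports, apart from one function that lives far
away. Cut `f` into the pieces `χ k (x) χ j (v) f`. The part `χ k (x) g` of `g` splits into pieces with
the same masses and mean velocities (`VConvexLE.exists_decomposition`): by the Hahn-Banach theorem
the obstruction would be a function `χ k (x) max_j (a_j + b_j · v)`, and these are test functions of
the order `≼`. For the Hahn-Banach theorem the set of attainable masses and means has to be closed;
it is the image of a bounded closed convex set in a Hilbert space under a continuous linear map
(`isClosed_image_of_isBounded`). Coupling corresponding pieces independently gives `P`, under which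
`v'` has conditional expectation `∑ χ k (x) χ j (v) b_kj`, where `b_kj` are the mean velocities of
the pieces, and this is close to `v`.

*Envelopes.* By Jensen's inequality `∑ i, l i • f π_i` dominates `f` in the order `≼`
(`vConvexLE_mixture`), which gives the lower growth bound for `rel Φ` and `inc (conv Φ) ≤ rel Φ`.
Conversely `rel Φ ≤ inc Φ`, because `rel Φ` is increasing and `rel Φ ≤ Φ`. The functional `inc Ψ` is
convex if `Ψ` is; applied to `conv Φ` this gives `inc (conv Φ) ≤ conv (inc Φ)`. If `Φ` is convex, then
`conv Φ = Φ` and the bounds for `rel Φ` coincide.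
-/

namespace RelaxedAction

variable {d : ℕ} {p : ℝ}

/-! ### Moments and elementary estimates -/

/-- The velocity moment `⟨f, |v|^p⟩`. -/
noncomputable def mom (f : PP d p) : ℝ := ∫ z : Phase d, ‖z.2‖ ^ p ∂f.1

instance (f : PP d p) : IsProbabilityMeasure f.1 := f.2.1

lemma PP.integrable_snd (f : PP d p) : Integrable (fun z : Phase d => ‖z.2‖ ^ p) f.1 := by
  have hm : Measurable fun z : Phase d => ‖z.2‖ ^ p := by fun_prop
  refine f.2.2.mono' hm.aestronglyMeasurable (ae_of_all _ fun z => ?_)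
  rw [Real.norm_of_nonneg (by positivity)]
  have : 0 ≤ ‖z.1‖ ^ p := by positivity
  linarith

lemma PP.integrable_fst (f : PP d p) : Integrable (fun z : Phase d => ‖z.1‖ ^ p) f.1 := by
  have hm : Measurable fun z : Phase d => ‖z.1‖ ^ p := by fun_prop
  refine f.2.2.mono' hm.aestronglyMeasurable (ae_of_all _ fun z => ?_)
  rw [Real.norm_of_nonneg (by positivity)]
  have : 0 ≤ ‖z.2‖ ^ p := by positivity
  linarith

lemma mom_nonneg (f : PP d p) : 0 ≤ mom f := integral_nonneg fun z => by positivity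

lemma pairing_eq (f : PP d p) (a b : ℝ) : pairing f a b = a + b * mom f := by
  unfold pairing mom
  rw [integral_add (integrable_const _) (f.integrable_snd.const_mul _), integral_const_mul]
  simp

lemma self_le_one_add_rpow {a : ℝ} (ha : 0 ≤ a) (hp : 1 ≤ p) : a ≤ 1 + a ^ p := by
  rcases le_total a 1 with h | h
  · have : 0 ≤ a ^ p := by positivity
    linarith
  · have := Real.self_le_rpow_of_one_le h hp
    linarith

lemma integrable_of_rpow {α : Type*} [MeasurableSpace α] {μ : Measure α} [IsFiniteMeasure μ]
    (hp : 1 ≤ p) {F : α → Vec d} (hF : AEStronglyMeasurable F μ)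
    (h : Integrable (fun a => ‖F a‖ ^ p) μ) : Integrable F μ :=
  ((integrable_const (1 : ℝ)).add h).mono' hF
    (ae_of_all _ fun _ => self_le_one_add_rpow (norm_nonneg _) hp)

lemma norm_add_rpow_le (hp : 1 ≤ p) (a b : Vec d) :
    ‖a + b‖ ^ p ≤ 2 ^ (p - 1) * (‖a‖ ^ p + ‖b‖ ^ p) :=
  (Real.rpow_le_rpow (norm_nonneg _) (norm_add_le a b) (by linarith)).trans
    (by exact_mod_cast NNReal.rpow_add_le_mul_rpow_add_rpow ‖a‖₊ ‖b‖₊ hp)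

lemma norm_sub_rpow_le (hp : 1 ≤ p) (a b : Vec d) :
    ‖a - b‖ ^ p ≤ 2 ^ (p - 1) * (‖a‖ ^ p + ‖b‖ ^ p) := by
  simpa [sub_eq_add_neg] using norm_add_rpow_le hp a (-b)

lemma convexOn_norm_rpow (hp : 1 ≤ p) : ConvexOn ℝ Set.univ (fun v : Vec d => ‖v‖ ^ p) := by
  have h1 : ConvexOn ℝ ((fun v : Vec d => ‖v‖) '' Set.univ) (fun r : ℝ => r ^ p) := by
    refine (convexOn_rpow hp).subset ?_ ?_
    · rintro _ ⟨v, -, rfl⟩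
      exact norm_nonneg v
    · exact ((convex_univ : Convex ℝ (Set.univ : Set (Vec d))).isPreconnected.image _
        continuous_norm.continuousOn).ordConnected.convex
  refine ConvexOn.comp h1 convexOn_univ_norm ?_
  rintro _ ⟨v, -, rfl⟩ _ ⟨w, -, rfl⟩ h
  exact Real.rpow_le_rpow (norm_nonneg _) h (by linarith)

/-! ### Kernels, couplings and the relaxation -/

lemma integral_combine {N : ℕ} {E : Type*} [NormedAddCommGroup E] [NormedSpace ℝ E]
    {l : Fin N → ℝ} (hl : ∀ i, 0 ≤ l i)
    {π : Fin N → Kernel (Phase d) (Vec d)} {z : Phase d} {h : Vec d → E}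
    (hi : ∀ i, Integrable h (π i z)) :
    ∫ w, h w ∂(combine l π z) = ∑ i, l i • ∫ w, h w ∂(π i z) := by
  change ∫ w, h w ∂(∑ i, ENNReal.ofReal (l i) • π i z) = _
  rw [integral_finsetSum_measure fun i _ => (hi i).smul_measure ENNReal.ofReal_ne_top]
  refine Finset.sum_congr rfl fun i _ => ?_
  rw [integral_smul_measure, ENNReal.toReal_ofReal (hl i)]

lemma isPKernel_combine {N : ℕ} {l : Fin N → ℝ} (hl : ∀ i, 0 ≤ l i) (hl1 : ∑ i, l i = 1)
    {π : Fin N → Kernel (Phase d) (Vec d)} (hπ : ∀ i, IsPKernel p (π i)) :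
    IsPKernel p (combine l π) := by
  constructor
  · refine ⟨fun z => ⟨?_⟩⟩
    change (∑ i, ENNReal.ofReal (l i) • π i z) Set.univ = 1
    have := fun i => (hπ i).1
    simp only [Measure.coe_finsetSum, Finset.sum_apply, Measure.smul_apply, measure_univ,
      smul_eq_mul, mul_one]
    rw [← ENNReal.ofReal_sum_of_nonneg fun i _ => hl i, hl1, ENNReal.ofReal_one]
  · intro z
    change Integrable _ (∑ i, ENNReal.ofReal (l i) • π i z)
    exact integrable_finsetSum_measure.2 fun i _ =>
      ((hπ i).2 z).smul_measure ENNReal.ofReal_ne_top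

lemma lower_bound_of_growth {c C : ℝ} {Φ : PP d p → ℝ} (hG : Growth c C Φ) {N : ℕ}
    {l : Fin N → ℝ} (hl : ∀ i, 0 ≤ l i) (hl1 : ∑ i, l i = 1) (g : Fin N → PP d p) :
    -C + c * ∑ i, l i * mom (g i) ≤ ∑ i, l i * Φ (g i) := by
  have : -C + c * ∑ i, l i * mom (g i) = ∑ i, l i * (-C + c * mom (g i)) := by
    simp only [mul_add, Finset.sum_add_distrib, ← Finset.sum_mul, hl1, Finset.mul_sum, one_mul]
    congr 1
    exact Finset.sum_congr rfl fun i _ => by ring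
  rw [this]
  refine Finset.sum_le_sum fun i _ => mul_le_mul_of_nonneg_left ?_ (hl i)
  have := (hG (g i)).1
  rwa [pairing_eq] at this

lemma bddBelow_relaxationValues {c C : ℝ} (hc : 0 ≤ c) {Φ : PP d p → ℝ} (hG : Growth c C Φ)
    (f : PP d p) : BddBelow (relaxationValues Φ f) := by
  refine ⟨-C, ?_⟩
  rintro a ⟨N, l, π, g, hl, hl1, -, -, -, rfl⟩
  have h1 := lower_bound_of_growth hG (fun i => (hl i).1) hl1 g
  have h2 : 0 ≤ c * ∑ i, l i * mom (g i) :=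
    mul_nonneg hc (Finset.sum_nonneg fun i _ => mul_nonneg (hl i).1 (mom_nonneg _))
  linarith

/-- Competitors for the relaxation may be given as joint laws instead of kernels. The `Γ i` are
laws of `((x, v), w)` with `(x, v) ∼ f`, and the martingale property is only required after
integration over measurable sets of `(x, v)`. Disintegration gives kernels that have the required
properties almost everywhere; on a null set they are replaced by `δ_v`. -/
lemma rel_le_of_jointLaws (hp : 1 ≤ p) {c C : ℝ} (hc : 0 ≤ c) {Φ : PP d p → ℝ}
    (hG : Growth c C Φ) (f : PP d p) {N : ℕ} {l : Fin N → ℝ}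
    (hl : ∀ i, l i ∈ Set.Icc (0 : ℝ) 1) (hl1 : ∑ i, l i = 1)
    (Γ : Fin N → Measure (Phase d × Vec d)) (hΓ : ∀ i, (Γ i).map Prod.fst = f.1)
    (g : Fin N → PP d p) (hg : ∀ i, (g i).1 = (Γ i).map (fun q => (q.1.1, q.2)))
    (hm : ∀ A, MeasurableSet A →
      ∑ i, l i • ∫ q in Prod.fst ⁻¹' A, (q.2 - q.1.2) ∂(Γ i) = 0) :
    rel Φ f ≤ ∑ i, l i * Φ (g i) := by
  have hprob : ∀ i, IsProbabilityMeasure (Γ i) := fun i => by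
    constructor
    have h1 : (Γ i).map Prod.fst Set.univ = 1 := by rw [hΓ i]; exact measure_univ
    rwa [Measure.map_apply measurable_fst MeasurableSet.univ, Set.preimage_univ] at h1
  set κ : Fin N → Kernel (Phase d) (Vec d) := fun i => (Γ i).condKernel with hκ
  have hdis : ∀ i, f.1 ⊗ₘ κ i = Γ i := fun i => by
    have := (Γ i).disintegrate (κ i)
    rwa [Measure.fst, hΓ i] at this
  have hrp : ∀ i, Integrable (fun q : Phase d × Vec d => ‖q.2‖ ^ p) (Γ i) := fun i => by
    have h1 := (g i).integrable_snd
    have hm : Measurable fun z : Phase d => ‖z.2‖ ^ p := by fun_prop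
    rw [hg i, integrable_map_measure hm.aestronglyMeasurable (by fun_prop)] at h1
    exact h1
  have hw : ∀ i, Integrable (fun q : Phase d × Vec d => q.2) (Γ i) := fun i =>
    integrable_of_rpow hp (by fun_prop) (hrp i)
  have hv : ∀ i, Integrable (fun q : Phase d × Vec d => q.1.2) (Γ i) := fun i => by
    have h1 : Integrable (fun z : Phase d => z.2) f.1 :=
      integrable_of_rpow hp (by fun_prop) f.integrable_snd
    rw [← hΓ i, integrable_map_measure (by fun_prop) (by fun_prop)] at h1
    exact h1
  have hae1 : ∀ᵐ z ∂f.1, ∀ i, Integrable (fun w : Vec d => ‖w‖ ^ p) (κ i z) := by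
    refine ae_all_iff.2 fun i => ?_
    have h1 := hrp i
    rw [← hdis i] at h1
    exact ((Measure.integrable_compProd_iff h1.aestronglyMeasurable).1 h1).1
  have hbi : ∀ i, Integrable (fun z => ∫ w, (w - z.2) ∂(κ i z)) f.1 := fun i => by
    have h1 := (hw i).sub (hv i)
    rw [← hdis i] at h1
    exact h1.integral_compProd
  have hae2 : ∀ᵐ z ∂f.1, ∑ i, l i • ∫ w, (w - z.2) ∂(κ i z) = 0 := by
    refine Integrable.ae_eq_zero_of_forall_setIntegral_eq_zero
      (integrable_finsetSum _ fun i _ => (hbi i).smul (l i)) fun A hA _ => ?_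
    refine (integral_finsetSum _ fun i _ => ((hbi i).smul (l i)).integrableOn).trans ?_
    rw [← hm A hA]
    refine Finset.sum_congr rfl fun i _ => ?_
    refine (integral_smul (μ := f.1.restrict A) (l i) fun z => ∫ w, (w - z.2) ∂(κ i z)).trans ?_
    congr 1
    have h1 := (hw i).sub (hv i)
    rw [← hdis i] at h1 ⊢
    have := Measure.setIntegral_compProd (s := A) (t := Set.univ) hA MeasurableSet.univ
      h1.integrableOn
    simp only [Measure.restrict_univ, Set.prod_univ] at this
    exact this.symm
  have hae : ∀ᵐ z ∂f.1, (∀ i, Integrable (fun w : Vec d => ‖w‖ ^ p) (κ i z)) ∧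
      ∑ i, l i • ∫ w, (w - z.2) ∂(κ i z) = 0 := hae1.and hae2
  obtain ⟨t, hst, ht, ht0⟩ := exists_measurable_superset_of_null (ae_iff.1 hae)
  classical
  set π : Fin N → Kernel (Phase d) (Vec d) := fun i =>
    Kernel.piecewise ht (Kernel.deterministic Prod.snd measurable_snd) (κ i) with hπ
  have hπt : ∀ i z, z ∈ t → π i z = Measure.dirac z.2 := fun i z hz => by
    simp [hπ, Kernel.piecewise_apply, hz, Kernel.deterministic_apply]
  have hπn : ∀ i z, z ∉ t → π i z = κ i z := fun i z hz => by
    simp [hπ, Kernel.piecewise_apply, hz]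
  have hgood : ∀ z, z ∉ t → (∀ i, Integrable (fun w : Vec d => ‖w‖ ^ p) (κ i z)) ∧
      ∑ i, l i • ∫ w, (w - z.2) ∂(κ i z) = 0 := fun z hz => by
    by_contra h
    exact hz (hst h)
  have hPK : ∀ i, IsPKernel p (π i) := fun i => by
    refine ⟨inferInstance, fun z => ?_⟩
    by_cases hz : z ∈ t
    · rw [hπt i z hz]
      exact integrable_dirac (by simp)
    · rw [hπn i z hz]
      exact (hgood z hz).1 i
  have hint : ∀ i z, Integrable (fun w : Vec d => w) (π i z) := fun i z =>
    have := (hPK i).1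
    integrable_of_rpow hp (by fun_prop) ((hPK i).2 z)
  refine csInf_le (bddBelow_relaxationValues hc hG f) ⟨N, l, π, g, hl, hl1, hPK, ⟨?_, ?_⟩, ?_, rfl⟩
  · exact isPKernel_combine (fun i => (hl i).1) hl1 hPK
  · intro z
    rw [integral_combine (fun i => (hl i).1) fun i => hint i z]
    by_cases hz : z ∈ t
    · simp only [hπt _ z hz, integral_dirac, ← Finset.sum_smul, hl1, one_smul]
    · have h1 := (hgood z hz).2
      have h2 : ∀ i, ∫ w, (w - z.2) ∂(κ i z) = ∫ w, w ∂(π i z) - z.2 := fun i => by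
        have := (hPK i).1
        rw [← hπn i z hz, integral_sub (hint i z) (integrable_const _)]
        simp
      simp only [h2, smul_sub, Finset.sum_sub_distrib, ← Finset.sum_smul, hl1, one_smul] at h1
      exact sub_eq_zero.1 h1
  · intro i
    rw [hg i, applyKernel, ← hdis i]
    congr 1
    refine Measure.compProd_congr ?_
    have : ∀ᵐ z ∂f.1, z ∉ t := by
      rw [ae_iff]; simpa using ht0
    filter_upwards [this] with z hz using (hπn i z hz).symm

lemma map_compProd_comap {α β γ : Type*} [MeasurableSpace α] [MeasurableSpace β]
    [MeasurableSpace γ] (μ : Measure α) [SFinite μ] (κ : Kernel β γ) [IsSFiniteKernel κ]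
    {h : α → β} (hh : Measurable h) :
    (μ ⊗ₘ κ.comap h hh).map (fun q => (h q.1, q.2)) = μ.map h ⊗ₘ κ := by
  ext s hs
  rw [Measure.map_apply (by fun_prop) hs,
    Measure.compProd_apply (measurableSet_preimage (by fun_prop) hs),
    Measure.compProd_apply hs, lintegral_map (Kernel.measurable_kernel_prodMk_left hs) hh]
  rfl

lemma isProbabilityMeasure_of_map_eq {Ω Ω' : Type*} [MeasurableSpace Ω] [MeasurableSpace Ω']
    {μ : Measure Ω} {ν : Measure Ω'} [IsProbabilityMeasure ν] {F : Ω → Ω'} (hF : Measurable F)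
    (h : μ.map F = ν) : IsProbabilityMeasure μ := by
  constructor
  have h1 : μ.map F Set.univ = 1 := by rw [h]; exact measure_univ
  rwa [Measure.map_apply hF MeasurableSet.univ, Set.preimage_univ] at h1

lemma integrable_rpow_add (hp : 1 ≤ p) {α : Type*} [MeasurableSpace α] {μ : Measure α}
    {F G : α → Vec d} (hF : Measurable F) (hG : Measurable G)
    (h1 : Integrable (fun a => ‖F a‖ ^ p) μ) (h2 : Integrable (fun a => ‖G a‖ ^ p) μ) :
    Integrable (fun a => ‖F a + G a‖ ^ p) μ := by
  have hm : Measurable fun a => ‖F a + G a‖ ^ p := by fun_prop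
  refine ((h1.add h2).const_mul (2 ^ (p - 1))).mono' hm.aestronglyMeasurable
    (ae_of_all _ fun a => ?_)
  rw [Real.norm_of_nonneg (by positivity)]
  exact norm_add_rpow_le hp _ _

lemma integrable_rpow_sub (hp : 1 ≤ p) {α : Type*} [MeasurableSpace α] {μ : Measure α}
    {F G : α → Vec d} (hF : Measurable F) (hG : Measurable G)
    (h1 : Integrable (fun a => ‖F a‖ ^ p) μ) (h2 : Integrable (fun a => ‖G a‖ ^ p) μ) :
    Integrable (fun a => ‖F a - G a‖ ^ p) μ := by
  simpa [sub_eq_add_neg] using integrable_rpow_add hp hF hG.neg h1 (by simpa using h2)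

/-- The law of a random element `F` of the phase space with finite moments of order `p`. -/
noncomputable def PP.law {Ω : Type*} [MeasurableSpace Ω] (μ : Measure Ω) [IsProbabilityMeasure μ]
    (F : Ω → Phase d) (hF : Measurable F) (h1 : Integrable (fun a => ‖(F a).1‖ ^ p) μ)
    (h2 : Integrable (fun a => ‖(F a).2‖ ^ p) μ) : PP d p :=
  ⟨μ.map F, Measure.isProbabilityMeasure_map hF.aemeasurable, by
    have hm : Measurable fun z : Phase d => ‖z.1‖ ^ p + ‖z.2‖ ^ p := by fun_prop
    exact (integrable_map_measure hm.aestronglyMeasurable hF.aemeasurable).2 (h1.add h2)⟩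

section laws

variable {Ω : Type*} [MeasurableSpace Ω] {μ : Measure Ω} {f g : PP d p} {F G : Ω → Phase d}

lemma integrable_snd_of_law (hF : Measurable F) (h : f.1 = μ.map F) :
    Integrable (fun a => ‖(F a).2‖ ^ p) μ := by
  have h1 := f.integrable_snd
  have hm : Measurable fun z : Phase d => ‖z.2‖ ^ p := by fun_prop
  rwa [h, integrable_map_measure hm.aestronglyMeasurable hF.aemeasurable] at h1

lemma integrable_fst_of_law (hF : Measurable F) (h : f.1 = μ.map F) :
    Integrable (fun a => ‖(F a).1‖ ^ p) μ := by
  have h1 := f.integrable_fst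
  have hm : Measurable fun z : Phase d => ‖z.1‖ ^ p := by fun_prop
  rwa [h, integrable_map_measure hm.aestronglyMeasurable hF.aemeasurable] at h1

lemma mom_eq_of_law (hF : Measurable F) (h : f.1 = μ.map F) :
    mom f = ∫ a, ‖(F a).2‖ ^ p ∂μ := by
  have hm : Measurable fun z : Phase d => ‖z.2‖ ^ p := by fun_prop
  rw [mom, h, integral_map hF.aemeasurable hm.aestronglyMeasurable]

lemma integrable_cost_of_law (hp : 1 ≤ p) (hF : Measurable F) (hG : Measurable G)
    (h1 : f.1 = μ.map F) (h2 : g.1 = μ.map G) :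
    Integrable (fun a => ‖(F a).1 - (G a).1‖ ^ p + ‖(F a).2 - (G a).2‖ ^ p) μ :=
  (integrable_rpow_sub hp (by fun_prop) (by fun_prop) (integrable_fst_of_law hF h1)
    (integrable_fst_of_law hG h2)).add
    (integrable_rpow_sub hp (by fun_prop) (by fun_prop) (integrable_snd_of_law hF h1)
      (integrable_snd_of_law hG h2))

lemma Wp_le_of_law (hp : 1 ≤ p) (hF : Measurable F) (hG : Measurable G)
    (h1 : f.1 = μ.map F) (h2 : g.1 = μ.map G) :
    Wp f g ≤
      (∫ a, (‖(F a).1 - (G a).1‖ ^ p + ‖(F a).2 - (G a).2‖ ^ p) ∂μ) ^ (1 / p) := by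
  have hm : Measurable fun q : Phase d × Phase d =>
      ENNReal.ofReal (‖q.1.1 - q.2.1‖ ^ p + ‖q.1.2 - q.2.2‖ ^ p) := by fun_prop
  have hFG : Measurable fun a => (F a, G a) := hF.prodMk hG
  have hmem : μ.map (fun a => (F a, G a)) ∈ couplings f g := by
    constructor
    · rw [Measure.map_map measurable_fst hFG, h1]; rfl
    · rw [Measure.map_map measurable_snd hFG, h2]; rfl
  have hint := integrable_cost_of_law hp hF hG h1 h2
  refine Real.rpow_le_rpow ENNReal.toReal_nonneg ?_ (by positivity)
  have hle := iInf₂_le (f := fun Γ (_ : Γ ∈ couplings f g) =>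
    ∫⁻ q, ENNReal.ofReal (‖q.1.1 - q.2.1‖ ^ p + ‖q.1.2 - q.2.2‖ ^ p) ∂Γ) _ hmem
  rw [lintegral_map hm hFG] at hle
  rw [← ofReal_integral_eq_lintegral_ofReal hint (ae_of_all _ fun a => by positivity)] at hle
  exact ENNReal.toReal_le_of_le_ofReal (integral_nonneg fun a => by positivity) hle

end laws

/-- The kernel `δ_v` shows that `Φ(f)` is a competitor for the relaxation at `f`. -/
lemma self_mem_relaxationValues (Φ : PP d p → ℝ) (f : PP d p) : Φ f ∈ relaxationValues Φ f := by
  have hK : IsPKernel p (Kernel.deterministic Prod.snd measurable_snd :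
      Kernel (Phase d) (Vec d)) := by
    refine ⟨inferInstance, fun z => ?_⟩
    rw [Kernel.deterministic_apply]
    exact integrable_dirac (by simp)
  refine ⟨1, fun _ => 1, fun _ => Kernel.deterministic Prod.snd measurable_snd, fun _ => f,
    fun _ => by simp, by simp, fun _ => hK,
    ⟨isPKernel_combine (fun _ => zero_le_one) (by simp) fun _ => hK, fun z => ?_⟩,
    fun _ => ?_, by simp⟩
  · rw [integral_combine (fun _ => zero_le_one)]
    · simp [Kernel.deterministic_apply]
    · intro i
      rw [Kernel.deterministic_apply]
      exact integrable_dirac (by simp)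
  · rw [applyKernel, Measure.compProd_deterministic, Measure.map_map (by fun_prop) (by fun_prop)]
    exact Measure.map_id.symm

lemma rel_le_self {c C : ℝ} (hc : 0 ≤ c) {Φ : PP d p → ℝ} (hG : Growth c C Φ)
    (f : PP d p) : rel Φ f ≤ Φ f :=
  csInf_le (bddBelow_relaxationValues hc hG f) (self_mem_relaxationValues Φ f)

/-- The constant in the continuity estimate `rel_le_rel_add_of_shift`. -/
noncomputable def shiftConst (p c C : ℝ) : ℝ :=
  3 * C ^ 2 * (1 + 2 ^ (p - 1)) / c + C * (1 + 2 ^ (p - 1))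

/-- The estimate behind both the continuity and the monotonicity of the relaxation. Under `P` let
`(z, z')` have marginals `f` and `g`, and let `s` be a random shift such that `v' + s` has
conditional expectation `v` given `z = (x, v)`. If `w` is drawn from a competitor kernel for `g` at
`z'`, then the law of `(z, w + s)` is a competitor for `f`, at distance at most
`(E |x - x'|^p + E |s|^p)^(1/p)` from the competitor for `g`. -/
lemma rel_le_rel_add_of_shift (hp : 1 < p) {c C : ℝ} (hc : 0 < c) (hC : 0 < C)
    {Φ : PP d p → ℝ} (hG : Growth c C Φ) (hW : WpEstimate C Φ) (f g : PP d p)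
    {P : Measure (Phase d × Phase d)} (hP1 : P.map Prod.fst = f.1) (hP2 : P.map Prod.snd = g.1)
    {s : Phase d × Phase d → Vec d} (hs : Measurable s) (hsi : Integrable (fun q => ‖s q‖ ^ p) P)
    (hm : ∀ A, MeasurableSet A → ∫ q in Prod.fst ⁻¹' A, (q.2.2 + s q - q.1.2) ∂P = 0) :
    rel Φ f ≤ rel Φ g + (shiftConst p c C * (2 + mom g + ∫ q, ‖s q‖ ^ p ∂P)) ^ ((p - 1) / p) *
      (∫ q, (‖q.1.1 - q.2.1‖ ^ p + ‖s q‖ ^ p) ∂P) ^ (1 / p) := by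
  have hP : IsProbabilityMeasure P := isProbabilityMeasure_of_map_eq measurable_fst hP1
  set S := ∫ q, ‖s q‖ ^ p ∂P with hS
  set e := ∫ q, (‖q.1.1 - q.2.1‖ ^ p + ‖s q‖ ^ p) ∂P with he
  have hS0 : 0 ≤ S := integral_nonneg fun q => by positivity
  have he0 : 0 ≤ e := integral_nonneg fun q => by positivity
  have hσ : 0 ≤ (p - 1) / p := div_nonneg (by linarith) (by linarith)
  have hσ1 : (p - 1) / p ≤ 1 := by rw [div_le_one (by linarith)]; linarith
  refine le_of_forall_pos_le_add fun ε hε => ?_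
  obtain ⟨a, ⟨N, l, π, gi, hl, hl1, hπ, hmart, hgi, rfl⟩, ha⟩ :
      ∃ a ∈ relaxationValues Φ g, a < rel Φ g + min ε C :=
    exists_lt_of_csInf_lt ⟨_, self_mem_relaxationValues Φ g⟩
      (lt_add_of_pos_right _ (lt_min hε hC))
  have hM : ∀ i, IsMarkovKernel (π i) := fun i => (hπ i).1
  set R : Fin N → Measure ((Phase d × Phase d) × Vec d) := fun i =>
    P ⊗ₘ (π i).comap Prod.snd measurable_snd with hR
  have hR1 : ∀ i, (R i).map Prod.fst = P := fun i => Measure.fst_compProd _ _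
  have hRz : ∀ i, (R i).map (fun r => r.1.1) = f.1 := fun i => by
    rw [← hP1, ← hR1 i, Measure.map_map measurable_fst measurable_fst]; rfl
  have hRg : ∀ i, (gi i).1 = (R i).map (fun r => (r.1.2.1, r.2)) := fun i => by
    rw [hgi i, applyKernel, ← hP2, ← map_compProd_comap P (π i) measurable_snd,
      Measure.map_map (by fun_prop) (by fun_prop)]
    rfl
  have hRx : ∀ i, Integrable (fun r => ‖r.1.1.1‖ ^ p) (R i) := fun i =>
    integrable_fst_of_law (f := f) (F := fun r : (Phase d × Phase d) × Vec d => r.1.1)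
      (by fun_prop) (hRz i).symm
  have hRv : ∀ i, Integrable (fun r => ‖r.1.1.2‖ ^ p) (R i) := fun i =>
    integrable_snd_of_law (f := f) (F := fun r : (Phase d × Phase d) × Vec d => r.1.1)
      (by fun_prop) (hRz i).symm
  have hRw : ∀ i, Integrable (fun r => ‖r.2‖ ^ p) (R i) := fun i =>
    integrable_snd_of_law (F := fun r : (Phase d × Phase d) × Vec d => (r.1.2.1, r.2))
      (by fun_prop) (hRg i)
  have hsm : Measurable fun q => ‖s q‖ ^ p := by fun_prop
  have hRs : ∀ i, Integrable (fun r => ‖s r.1‖ ^ p) (R i) := fun i => by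
    have h1 := hsi
    rw [← hR1 i, integrable_map_measure hsm.aestronglyMeasurable (by fun_prop)] at h1
    exact h1
  set g' : Fin N → PP d p := fun i => PP.law (R i) (fun r => (r.1.1.1, r.2 + s r.1))
    (by fun_prop) (hRx i)
    (integrable_rpow_add hp.le measurable_snd (by fun_prop) (hRw i) (hRs i)) with hg'
  have hg'law : ∀ i, (g' i).1 = (R i).map (fun r => (r.1.1.1, r.2 + s r.1)) := fun i => rfl
  have key : rel Φ f ≤ ∑ i, l i * Φ (g' i) := by
    refine rel_le_of_jointLaws hp.le hc.le hG f hl hl1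
      (fun i => (R i).map fun r => (r.1.1, r.2 + s r.1)) (fun i => ?_) g' (fun i => ?_) ?_
    · rw [Measure.map_map measurable_fst (by fun_prop), ← hRz i]; rfl
    · rw [hg'law i, Measure.map_map (by fun_prop) (by fun_prop)]; rfl
    · intro A hA
      have hint : ∀ i, Integrable (fun r : (Phase d × Phase d) × Vec d =>
          r.2 + s r.1 - r.1.1.2) (R i) := fun i =>
        ((integrable_of_rpow hp.le (by fun_prop) (hRw i)).add
          (integrable_of_rpow hp.le (hs.comp measurable_fst).aestronglyMeasurable (hRs i))).sub
          (integrable_of_rpow hp.le (by fun_prop) (hRv i))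
      have h1 : ∀ i, ∫ q in Prod.fst ⁻¹' A, (q.2 - q.1.2)
          ∂((R i).map fun r => (r.1.1, r.2 + s r.1)) =
          ∫ q in Prod.fst ⁻¹' A, (∫ w, (w + s q - q.1.2) ∂(π i q.2)) ∂P := fun i => by
        rw [setIntegral_map (measurable_fst hA) (by fun_prop) (by fun_prop)]
        have := Measure.setIntegral_compProd (s := Prod.fst ⁻¹' A) (t := Set.univ)
          (measurable_fst hA) MeasurableSet.univ (hint i).integrableOn
        simp only [Measure.restrict_univ, Set.prod_univ] at this
        exact this
      have hIi : ∀ i, Integrable (fun q => l i • ∫ w, (w + s q - q.1.2) ∂(π i q.2))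
          (P.restrict (Prod.fst ⁻¹' A)) := fun i =>
        ((hint i).integral_compProd.smul (l i)).integrableOn
      have h4 : ∀ i, l i • ∫ q in Prod.fst ⁻¹' A, (∫ w, (w + s q - q.1.2) ∂(π i q.2)) ∂P =
          ∫ q in Prod.fst ⁻¹' A, l i • (∫ w, (w + s q - q.1.2) ∂(π i q.2)) ∂P := fun i =>
        (integral_smul _ _).symm
      simp only [h1, h4]
      rw [← integral_finsetSum _ fun i _ => hIi i, ← hm A hA]
      refine setIntegral_congr_fun (measurable_fst hA) fun q _ => ?_
      have hwi : ∀ i, Integrable (fun w : Vec d => w) (π i q.2) := fun i =>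
        integrable_of_rpow hp.le (by fun_prop) ((hπ i).2 q.2)
      have h2 := hmart.2 q.2
      rw [integral_combine (fun i => (hl i).1) hwi] at h2
      have h3 : ∀ i, ∫ w, (w + s q - q.1.2) ∂(π i q.2) = ∫ w, w ∂(π i q.2) + (s q - q.1.2) :=
        fun i => by
          simp only [add_sub_assoc]
          rw [integral_add (hwi i) (integrable_const _)]
          simp
      simp only [h3, smul_add, Finset.sum_add_distrib, h2, ← Finset.sum_smul, hl1, one_smul]
      abel
  -- the competitors `g' i` and `gi i` are close
  have hWi : ∀ i, Wp (g' i) (gi i) ≤ e ^ (1 / p) := fun i => by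
    refine (Wp_le_of_law hp.le (by fun_prop) (by fun_prop) (hg'law i) (hRg i)).trans_eq ?_
    have hcm : Measurable fun q : Phase d × Phase d =>
      ‖q.1.1 - q.2.1‖ ^ p + ‖s q‖ ^ p := by fun_prop
    rw [he, ← hR1 i, integral_map (by fun_prop) hcm.aestronglyMeasurable]
    simp
  have hmomi : ∀ i, mom (g' i) ≤ 2 ^ (p - 1) * (mom (gi i) + S) := fun i => by
    rw [mom_eq_of_law (by fun_prop) (hg'law i), mom_eq_of_law (by fun_prop) (hRg i), hS]
    have h1 : ∫ q, ‖s q‖ ^ p ∂P = ∫ r, ‖s r.1‖ ^ p ∂(R i) := by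
      rw [← hR1 i, integral_map (by fun_prop) hsm.aestronglyMeasurable]
    rw [h1, ← integral_add (hRw i) (hRs i), ← integral_const_mul]
    exact integral_mono
      (integrable_rpow_add hp.le measurable_snd (by fun_prop) (hRw i) (hRs i))
      (((hRw i).add (hRs i)).const_mul _) fun r => norm_add_rpow_le hp.le _ _
  set A : Fin N → ℝ := fun i => pairing (g' i) C C + pairing (gi i) C C with hA
  have hA0 : ∀ i, 0 ≤ A i := fun i => by
    simp only [hA, pairing_eq]
    have := mom_nonneg (g' i)
    have := mom_nonneg (gi i)
    positivity
  have h1 : ∀ i, Φ (g' i) ≤ Φ (gi i) + A i ^ ((p - 1) / p) * e ^ (1 / p) := fun i => by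
    have h2 := (abs_le.1 (hW (g' i) (gi i))).2
    have h3 := mul_le_mul_of_nonneg_left (hWi i) (Real.rpow_nonneg (hA0 i) ((p - 1) / p))
    linarith
  have h2 : ∑ i, l i * A i ^ ((p - 1) / p) ≤ (∑ i, l i * A i) ^ ((p - 1) / p) := by
    have := (Real.concaveOn_rpow hσ hσ1).le_map_sum (t := Finset.univ) (w := l) (p := A)
      (fun i _ => (hl i).1) hl1 (fun i _ => hA0 i)
    simpa only [smul_eq_mul] using this
  -- the growth condition bounds the moments of an almost optimal competitor
  have h3 : ∑ i, l i * A i ≤ shiftConst p c C * (2 + mom g + S) := by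
    have hlow := lower_bound_of_growth hG (fun i => (hl i).1) hl1 gi
    have hup := (rel_le_self hc.le hG g).trans (hG g).2
    rw [pairing_eq] at hup
    set m := ∑ i, l i * mom (gi i) with hm'
    set D : ℝ := 2 ^ (p - 1) with hD
    have hD0 : 0 < D := by positivity
    have hmg := mom_nonneg g
    have hmc : c * m ≤ 3 * C + C * mom g := by
      have := min_le_right ε C
      linarith
    have hm3 : m ≤ (3 * C + C * mom g) / c := by
      rw [le_div_iff₀ hc]; linarith
    have h4 : ∑ i, l i * A i ≤ ∑ i, l i * (2 * C + C * (1 + D) * mom (gi i) + C * D * S) := by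
      refine Finset.sum_le_sum fun i _ => mul_le_mul_of_nonneg_left ?_ (hl i).1
      simp only [hA, pairing_eq]
      have := mul_le_mul_of_nonneg_left (hmomi i) hC.le
      linarith
    have h5 : ∑ i, l i * (2 * C + C * (1 + D) * mom (gi i) + C * D * S) =
        2 * C + C * (1 + D) * m + C * D * S := by
      have h6 : ∀ i, l i * (2 * C + C * (1 + D) * mom (gi i) + C * D * S) =
        l i * (2 * C + C * D * S) + C * (1 + D) * (l i * mom (gi i)) := fun i => by ring
      simp only [h6, Finset.sum_add_distrib, ← Finset.sum_mul, ← Finset.mul_sum, hl1, ← hm']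
      ring
    have h7 : C * (1 + D) * m ≤ C * (1 + D) * ((3 * C + C * mom g) / c) :=
      mul_le_mul_of_nonneg_left hm3 (by positivity)
    have h8 : C * (1 + D) * ((3 * C + C * mom g) / c) ≤
        3 * C ^ 2 * (1 + D) / c * (2 + mom g + S) := by
      have : 3 * C ^ 2 * (1 + D) / c * (2 + mom g + S) -
        C * (1 + D) * ((3 * C + C * mom g) / c) =
        C ^ 2 * (1 + D) / c * (3 + 2 * mom g + 3 * S) := by field_simp; ring
      have h9 : 0 ≤ C ^ 2 * (1 + D) / c * (3 + 2 * mom g + 3 * S) := by positivity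
      linarith
    have h10 : 2 * C + C * D * S ≤ C * (1 + D) * (2 + mom g + S) := by
      have : C * (1 + D) * (2 + mom g + S) - (2 * C + C * D * S) =
        C * (1 + D) * mom g + C * S + 2 * C * D := by ring
      have h9 : 0 ≤ C * (1 + D) * mom g + C * S + 2 * C * D := by positivity
      linarith
    have h11 : shiftConst p c C * (2 + mom g + S) = 3 * C ^ 2 * (1 + D) / c * (2 + mom g + S) +
      C * (1 + D) * (2 + mom g + S) := by rw [shiftConst]; ring
    linarith
  have h4 : 0 ≤ ∑ i, l i * A i := Finset.sum_nonneg fun i _ => mul_nonneg (hl i).1 (hA0 i)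
  calc rel Φ f ≤ ∑ i, l i * Φ (g' i) := key
    _ ≤ ∑ i, l i * (Φ (gi i) + A i ^ ((p - 1) / p) * e ^ (1 / p)) :=
        Finset.sum_le_sum fun i _ => mul_le_mul_of_nonneg_left (h1 i) (hl i).1
    _ = ∑ i, l i * Φ (gi i) + (∑ i, l i * A i ^ ((p - 1) / p)) * e ^ (1 / p) := by
        simp only [mul_add, Finset.sum_add_distrib, Finset.sum_mul, mul_assoc]
    _ ≤ (rel Φ g + ε) +
        (shiftConst p c C * (2 + mom g + S)) ^ ((p - 1) / p) * e ^ (1 / p) := by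
        refine add_le_add (ha.le.trans (add_le_add_right (min_le_left _ _) _)) ?_
        exact mul_le_mul_of_nonneg_right (h2.trans (Real.rpow_le_rpow h4 h3 hσ))
          (Real.rpow_nonneg he0 _)
    _ = _ := by ring

/-! ### Continuity of the relaxation -/

lemma exists_coupling_integral_lt (hp : 1 < p) {f g : PP d p} {r : ℝ} (hr : Wp f g < r) :
    ∃ Γ ∈ couplings f g,
      ∫ q, (‖q.1.1 - q.2.1‖ ^ p + ‖q.1.2 - q.2.2‖ ^ p) ∂Γ < r ^ p := by
  have hp0 : 0 < p := by linarith
  have hfin : ∀ Γ ∈ couplings f g, Integrable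
      (fun q => ‖q.1.1 - q.2.1‖ ^ p + ‖q.1.2 - q.2.2‖ ^ p) Γ := fun Γ hΓ =>
    integrable_cost_of_law hp.le measurable_fst measurable_snd hΓ.1.symm hΓ.2.symm
  have hW0 : 0 ≤ Wp f g := Real.rpow_nonneg ENNReal.toReal_nonneg _
  have hr0 : 0 < r := hW0.trans_lt hr
  set I := ⨅ Γ ∈ couplings f g,
    ∫⁻ q, ENNReal.ofReal (‖q.1.1 - q.2.1‖ ^ p + ‖q.1.2 - q.2.2‖ ^ p) ∂Γ with hI
  have hIfin : I ≠ ⊤ := by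
    have hmem : f.1.prod g.1 ∈ couplings f g := by
      constructor <;> simp
    refine ((iInf₂_le _ hmem).trans_lt ?_).ne
    rw [← ofReal_integral_eq_lintegral_ofReal (hfin _ hmem) (ae_of_all _ fun a => by positivity)]
    exact ENNReal.ofReal_lt_top
  have h1 : I.toReal < r ^ p := by
    have h2 : I.toReal ^ (1 / p) < r := hr
    have h3 := Real.rpow_lt_rpow (Real.rpow_nonneg ENNReal.toReal_nonneg _) h2 hp0
    rwa [← Real.rpow_mul ENNReal.toReal_nonneg, one_div_mul_cancel hp0.ne', Real.rpow_one] at h3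
  have h2 : I < ENNReal.ofReal (r ^ p) := (ENNReal.lt_ofReal_iff_toReal_lt hIfin).2 h1
  simp only [hI, iInf_lt_iff] at h2
  obtain ⟨Γ, hΓ, hlt⟩ := h2
  refine ⟨Γ, hΓ, ?_⟩
  rw [← ofReal_integral_eq_lintegral_ofReal (hfin _ hΓ) (ae_of_all _ fun a => by positivity)] at hlt
  exact (ENNReal.ofReal_lt_ofReal_iff (by positivity)).1 hlt

lemma Wp_nonneg (f g : PP d p) : 0 ≤ Wp f g := Real.rpow_nonneg ENNReal.toReal_nonneg _

lemma rpow_one_div_le_of_lt (hp : 1 < p) {a r : ℝ} (ha : 0 ≤ a) (hr : 0 ≤ r) (h : a < r ^ p) :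
    a ^ (1 / p) ≤ r := by
  have hp0 : 0 < p := by linarith
  have h1 := Real.rpow_le_rpow ha h.le (by positivity : 0 ≤ 1 / p)
  rwa [← Real.rpow_mul hr, mul_one_div_cancel hp0.ne', Real.rpow_one] at h1

lemma Wp_comm_le (hp : 1 < p) (f g : PP d p) : Wp g f ≤ Wp f g := by
  refine le_of_forall_gt_imp_ge_of_dense fun r hr => ?_
  obtain ⟨Γ, hΓ, hlt⟩ := exists_coupling_integral_lt hp hr
  refine (Wp_le_of_law hp.le measurable_snd measurable_fst hΓ.2.symm hΓ.1.symm).trans ?_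
  simp only [norm_sub_rev _ (Prod.snd (Prod.fst _)), norm_sub_rev _ (Prod.fst (Prod.fst _))]
  exact rpow_one_div_le_of_lt hp (integral_nonneg fun q => by positivity)
    ((Wp_nonneg f g).trans hr.le) hlt

lemma rel_le_rel_add_Wp (hp : 1 < p) {c C : ℝ} (hc : 0 < c) (hC : 0 < C)
    {Φ : PP d p → ℝ} (hG : Growth c C Φ) (hW : WpEstimate C Φ) (f g : PP d p) :
    rel Φ f ≤ rel Φ g +
      (shiftConst p c C * (1 + 2 ^ (p - 1)) * (2 + mom f + mom g)) ^ ((p - 1) / p) * Wp f g := by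
  have hσ : 0 ≤ (p - 1) / p := div_nonneg (by linarith) (by linarith)
  have hK : 0 < shiftConst p c C := by unfold shiftConst; positivity
  have hf := mom_nonneg f
  have hg := mom_nonneg g
  set Q := (shiftConst p c C * (1 + 2 ^ (p - 1)) * (2 + mom f + mom g)) ^ ((p - 1) / p) with hQ
  have hQ0 : 0 < Q := by positivity
  have key : ∀ r, Wp f g < r → rel Φ f ≤ rel Φ g + Q * r := fun r hr => by
    obtain ⟨Γ, hΓ, hlt⟩ := exists_coupling_integral_lt hp hr
    have i1 := integrable_snd_of_law (f := f) (F := Prod.fst) measurable_fst hΓ.1.symm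
    have i2 := integrable_snd_of_law (f := g) (F := Prod.snd) measurable_snd hΓ.2.symm
    have i3 := integrable_rpow_sub hp.le (by fun_prop) (by fun_prop) i1 i2
    have h1 := rel_le_rel_add_of_shift hp hc hC hG hW f g hΓ.1 hΓ.2
      (s := fun q => q.1.2 - q.2.2) (by fun_prop) i3 (fun A _ => by simp)
    refine h1.trans (add_le_add_right (mul_le_mul ?_ (rpow_one_div_le_of_lt hp
      (integral_nonneg fun q => by positivity) ((Wp_nonneg f g).trans hr.le) hlt)
      (Real.rpow_nonneg (integral_nonneg fun q => by positivity) _) hQ0.le) _)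
    have hS0 : 0 ≤ ∫ q, ‖q.1.2 - q.2.2‖ ^ p ∂Γ := integral_nonneg fun q => by positivity
    refine Real.rpow_le_rpow (by positivity) ?_ hσ
    have hS : ∫ q, ‖q.1.2 - q.2.2‖ ^ p ∂Γ ≤ 2 ^ (p - 1) * (mom f + mom g) := by
      rw [mom_eq_of_law (f := f) measurable_fst hΓ.1.symm,
        mom_eq_of_law (f := g) measurable_snd hΓ.2.symm, ← integral_add i1 i2,
        ← integral_const_mul]
      exact integral_mono i3 ((i1.add i2).const_mul _) fun q => norm_sub_rpow_le hp.le _ _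
    rw [mul_assoc]
    refine mul_le_mul_of_nonneg_left ?_ hK.le
    have h2 : (0 : ℝ) < 2 ^ (p - 1) := by positivity
    nlinarith
  have h1 : (rel Φ f - rel Φ g) / Q ≤ Wp f g := by
    refine le_of_forall_gt_imp_ge_of_dense fun r hr => ?_
    rw [div_le_iff₀ hQ0]
    linarith [key r hr]
  rw [div_le_iff₀ hQ0] at h1
  linarith

/-- The constant in the `W_p`-estimate for the relaxation; the terms `c + C` only serve to make it
larger than `c` and `C`. -/
noncomputable def relConst (p c C : ℝ) : ℝ :=
  shiftConst p c C * (1 + 2 ^ (p - 1)) + c + C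

lemma wpEstimate_rel (hp : 1 < p) {c C : ℝ} (hc : 0 < c) (hC : 0 < C)
    {Φ : PP d p → ℝ} (hG : Growth c C Φ) (hW : WpEstimate C Φ) :
    WpEstimate (relConst p c C) (rel Φ) := by
  have hσ : 0 ≤ (p - 1) / p := div_nonneg (by linarith) (by linarith)
  have hK : 0 < shiftConst p c C := by unfold shiftConst; positivity
  have key : ∀ f g : PP d p, rel Φ f - rel Φ g ≤
      (relConst p c C * (2 + mom f + mom g)) ^ ((p - 1) / p) * Wp f g := fun f g => by
    have hf := mom_nonneg f
    have hg := mom_nonneg g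
    have h1 := rel_le_rel_add_Wp hp hc hC hG hW f g
    have h2 : (shiftConst p c C * (1 + 2 ^ (p - 1)) * (2 + mom f + mom g)) ^ ((p - 1) / p) ≤
        (relConst p c C * (2 + mom f + mom g)) ^ ((p - 1) / p) := by
      refine Real.rpow_le_rpow (by positivity) ?_ hσ
      refine mul_le_mul_of_nonneg_right ?_ (by positivity)
      unfold relConst
      linarith
    have h3 := mul_le_mul_of_nonneg_right h2 (Wp_nonneg f g)
    linarith
  intro f g
  have e1 : pairing f (relConst p c C) (relConst p c C) +
      pairing g (relConst p c C) (relConst p c C) = relConst p c C * (2 + mom f + mom g) := by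
    simp only [pairing_eq]; ring
  rw [e1, abs_le]
  have h1 := key f g
  have h2 := key g f
  rw [show 2 + mom g + mom f = 2 + mom f + mom g by ring,
    le_antisymm (Wp_comm_le hp f g) (Wp_comm_le hp g f)] at h2
  constructor <;> linarith

lemma WpEstimate.wpContinuous (hp : 1 < p) {C : ℝ} (hC : 0 < C)
    {Ψ : PP d p → ℝ} (hW : WpEstimate C Ψ) : WpContinuous Ψ := by
  intro f ε hε
  have hσ : 0 ≤ (p - 1) / p := div_nonneg (by linarith) (by linarith)
  have hf := mom_nonneg f
  set Q := (C * (2 + mom f + 2 ^ (p - 1) * (mom f + 1))) ^ ((p - 1) / p) with hQ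
  have hQ0 : 0 < Q := by positivity
  refine ⟨min 1 (ε / Q), by positivity, fun g hg => ?_⟩
  have hmg : mom g ≤ 2 ^ (p - 1) * (mom f + 1) := by
    obtain ⟨Γ, hΓ, hlt⟩ := exists_coupling_integral_lt hp (hg.trans_le (min_le_left _ _))
    rw [Real.one_rpow] at hlt
    have i1 := integrable_snd_of_law (f := f) (F := Prod.fst) measurable_fst hΓ.1.symm
    have i2 := integrable_snd_of_law (f := g) (F := Prod.snd) measurable_snd hΓ.2.symm
    have i3 := integrable_cost_of_law hp.le measurable_fst measurable_snd hΓ.1.symm hΓ.2.symm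
    have h1 : mom g ≤ 2 ^ (p - 1) *
        (mom f + ∫ q, (‖q.1.1 - q.2.1‖ ^ p + ‖q.1.2 - q.2.2‖ ^ p) ∂Γ) := by
      rw [mom_eq_of_law (f := f) measurable_fst hΓ.1.symm,
        mom_eq_of_law (f := g) measurable_snd hΓ.2.symm, ← integral_add i1 i3,
        ← integral_const_mul]
      refine integral_mono i2 ((i1.add i3).const_mul _) fun q => ?_
      have h2 := norm_sub_rpow_le hp.le q.1.2 (q.1.2 - q.2.2)
      rw [sub_sub_cancel] at h2
      refine h2.trans (mul_le_mul_of_nonneg_left ?_ (by positivity))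
      have : 0 ≤ ‖q.1.1 - q.2.1‖ ^ p := by positivity
      linarith
    refine h1.trans (mul_le_mul_of_nonneg_left ?_ (by positivity))
    linarith
  have hg0 := mom_nonneg g
  have h1 := hW f g
  rw [abs_sub_comm]
  simp only [pairing_eq] at h1
  have h2 : (C + C * mom f + (C + C * mom g)) ^ ((p - 1) / p) ≤ Q := by
    refine Real.rpow_le_rpow (by positivity) ?_ hσ
    have := mul_le_mul_of_nonneg_left hmg hC.le
    linarith
  calc |Ψ f - Ψ g| ≤ _ := h1
    _ ≤ Q * Wp f g := mul_le_mul_of_nonneg_right h2 (Wp_nonneg f g)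
    _ < Q * (ε / Q) := by
        exact mul_lt_mul_of_pos_left (hg.trans_le (min_le_right _ _)) hQ0
    _ = ε := by field_simp

/-! ### The velocity-convex order and convex functionals -/

lemma one_add_rpow_le (hp : 1 ≤ p) {a b : ℝ} (ha : 0 ≤ a) (hb : 0 ≤ b) :
    (1 + a + b) ^ p ≤ 4 ^ p * (1 + a ^ p + b ^ p) := by
  have key : ∀ {x y : ℝ}, 0 ≤ x → 0 ≤ y → (x + y) ^ p ≤ 2 ^ p * (x ^ p + y ^ p) := by
    intro x y hx hy
    have h1 : (x + y) ^ p ≤ (2 * max x y) ^ p :=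
      Real.rpow_le_rpow (by positivity) (by linarith [le_max_left x y, le_max_right x y])
        (by linarith)
    rw [Real.mul_rpow (by norm_num) (by positivity)] at h1
    refine h1.trans (mul_le_mul_of_nonneg_left ?_ (by positivity))
    have hx' : 0 ≤ x ^ p := by positivity
    have hy' : 0 ≤ y ^ p := by positivity
    rcases max_cases x y with ⟨h, -⟩ | ⟨h, -⟩ <;> rw [h] <;> linarith
  have h1 := key (x := 1 + a) (y := b) (by positivity) hb
  have h2 := key (x := 1) (y := a) zero_le_one ha
  rw [Real.one_rpow] at h2
  have h3 : (4 : ℝ) ^ p = 2 ^ p * 2 ^ p := by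
    rw [← Real.mul_rpow (by norm_num) (by norm_num)]; norm_num
  have h4 : (1 : ℝ) ≤ 2 ^ p := Real.one_le_rpow (by norm_num) (by linarith)
  have hb' : 0 ≤ b ^ p := by positivity
  rw [h3]
  nlinarith [mul_le_mul_of_nonneg_left h2 (by positivity : (0 : ℝ) ≤ 2 ^ p),
    mul_nonneg (mul_nonneg (by positivity : (0 : ℝ) ≤ 2 ^ p) hb') (sub_nonneg.2 h4)]

lemma abs_le_of_growth (hp : 1 ≤ p) {φ : Phase d → ℝ} {K : ℝ}
    (hφ : ∀ x v, |φ (x, v)| ≤ K * (1 + ‖x‖ + ‖v‖) ^ p) (x v : Vec d) :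
    |φ (x, v)| ≤ K * 4 ^ p * (1 + ‖x‖ ^ p + ‖v‖ ^ p) := by
  have h0 : 0 ≤ K := by
    have := (abs_nonneg _).trans (hφ 0 0)
    simpa using this
  rw [mul_assoc]
  exact (hφ x v).trans
    (mul_le_mul_of_nonneg_left (one_add_rpow_le hp (norm_nonneg _) (norm_nonneg _)) h0)

lemma integrable_of_growth (hp : 1 ≤ p) (f : PP d p) {φ : Phase d → ℝ} (hc : Continuous φ)
    {K : ℝ} (hφ : ∀ x v, |φ (x, v)| ≤ K * (1 + ‖x‖ + ‖v‖) ^ p) : Integrable φ f.1 := by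
  refine ((((integrable_const (1 : ℝ)).add f.integrable_fst).add f.integrable_snd).const_mul
    (K * 4 ^ p)).mono' hc.aestronglyMeasurable (ae_of_all _ fun z => ?_)
  exact abs_le_of_growth hp hφ z.1 z.2

lemma mom_le_of_vConvexLE (hp : 1 ≤ p) {f g : PP d p} (h : VConvexLE f g) : mom f ≤ mom g := by
  refine h (fun z => ‖z.2‖ ^ p) ?_ (fun x => convexOn_norm_rpow hp) ⟨1, fun x v => ?_⟩
  · exact (continuous_snd.norm).rpow_const fun _ => Or.inr (by linarith)
  · rw [abs_of_nonneg (by positivity), one_mul]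
    exact Real.rpow_le_rpow (norm_nonneg _) (by linarith [norm_nonneg x]) (by linarith)

/-- The finite convex combination `∑ i, l i • g i` of elements of `𝒫_p`. -/
noncomputable def PP.mixture {N : ℕ} (l : Fin N → ℝ) (hl : ∀ i, 0 ≤ l i) (hl1 : ∑ i, l i = 1)
    (g : Fin N → PP d p) : PP d p :=
  ⟨∑ i, ENNReal.ofReal (l i) • (g i).1, by
    constructor
    · constructor
      simp only [Measure.coe_finsetSum, Finset.sum_apply, Measure.smul_apply, measure_univ,
        smul_eq_mul, mul_one]
      rw [← ENNReal.ofReal_sum_of_nonneg fun i _ => hl i, hl1, ENNReal.ofReal_one]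
    · exact integrable_finsetSum_measure.2 fun i _ =>
        (g i).2.2.smul_measure ENNReal.ofReal_ne_top⟩

lemma integral_mixture {N : ℕ} {l : Fin N → ℝ} (hl : ∀ i, 0 ≤ l i) (hl1 : ∑ i, l i = 1)
    (g : Fin N → PP d p) {φ : Phase d → ℝ} (hφ : ∀ i, Integrable φ (g i).1) :
    ∫ z, φ z ∂(PP.mixture l hl hl1 g).1 = ∑ i, l i * ∫ z, φ z ∂(g i).1 := by
  change ∫ z, φ z ∂(∑ i, ENNReal.ofReal (l i) • (g i).1) = _
  rw [integral_finsetSum_measure fun i _ => (hφ i).smul_measure ENNReal.ofReal_ne_top]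
  refine Finset.sum_congr rfl fun i _ => ?_
  rw [integral_smul_measure, ENNReal.toReal_ofReal (hl i), smul_eq_mul]

lemma IsConvex.map_mixture_le {Ψ : PP d p → ℝ} (hΨ : IsConvex Ψ) :
    ∀ {N : ℕ} (l : Fin N → ℝ) (hl : ∀ i, 0 ≤ l i) (hl1 : ∑ i, l i = 1) (g : Fin N → PP d p),
      Ψ (PP.mixture l hl hl1 g) ≤ ∑ i, l i * Ψ (g i)
  | 0, l, hl, hl1, g => by simp at hl1
  | N + 1, l, hl, hl1, g => by
    have hs := hl1
    rw [Fin.sum_univ_succ] at hs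
    have hsn : 0 ≤ ∑ i : Fin N, l i.succ := Finset.sum_nonneg fun i _ => hl _
    -- split off the index `0`, and renormalize the remaining weights unless they all vanish
    rcases eq_or_lt_of_le hsn with h0 | h0
    · have hz : ∀ i : Fin N, l i.succ = 0 := fun i =>
        (Finset.sum_eq_zero_iff_of_nonneg fun i _ => hl _).1 h0.symm i (Finset.mem_univ _)
      have hl0 : l 0 = 1 := by linarith
      have : PP.mixture l hl hl1 g = g 0 := by
        refine Subtype.ext ?_
        change ∑ i, ENNReal.ofReal (l i) • (g i).1 = (g 0).1
        rw [Fin.sum_univ_succ]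
        simp [hz, hl0]
      rw [this, Fin.sum_univ_succ]
      simp [hz, hl0]
    · set t := ∑ i : Fin N, l i.succ with ht
      have hl' : ∀ i : Fin N, 0 ≤ l i.succ / t := fun i => div_nonneg (hl _) hsn
      have hl1' : ∑ i : Fin N, l i.succ / t = 1 := by
        rw [← Finset.sum_div, ← ht, div_self h0.ne']
      have htm : t ∈ Set.Icc (0 : ℝ) 1 := ⟨hsn, by linarith [hl 0]⟩
      have e : PP.mixture l hl hl1 g =
          mix t htm (g 0) (PP.mixture _ hl' hl1' fun i => g i.succ) := by
        refine Subtype.ext ?_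
        change ∑ i, ENNReal.ofReal (l i) • (g i).1 = ENNReal.ofReal (1 - t) • (g 0).1 +
          ENNReal.ofReal t • ∑ i : Fin N, ENNReal.ofReal (l i.succ / t) • (g i.succ).1
        rw [Fin.sum_univ_succ, Finset.smul_sum, show 1 - t = l 0 by linarith]
        congr 1
        refine Finset.sum_congr rfl fun i _ => ?_
        rw [smul_smul, ← ENNReal.ofReal_mul hsn, mul_div_cancel₀ _ h0.ne']
      have h1 := hΨ (g 0) (PP.mixture _ hl' hl1' fun i => g i.succ) t htm
      have h2 := hΨ.map_mixture_le _ hl' hl1' fun i => g i.succ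
      rw [e, Fin.sum_univ_succ]
      refine h1.trans ?_
      rw [show 1 - t = l 0 by linarith]
      refine add_le_add_right ((mul_le_mul_of_nonneg_left h2 hsn).trans_eq ?_) _
      rw [Finset.mul_sum]
      refine Finset.sum_congr rfl fun i _ => ?_
      field_simp

/-- Jensen's inequality for the martingale kernel `∑ i, l i • π i`. -/
lemma vConvexLE_mixture (hp : 1 ≤ p) {f : PP d p} {N : ℕ} {l : Fin N → ℝ}
    {π : Fin N → Kernel (Phase d) (Vec d)} {g : Fin N → PP d p} (hl : ∀ i, 0 ≤ l i)
    (hl1 : ∑ i, l i = 1) (hπ : ∀ i, IsPKernel p (π i)) (hm : IsMartingaleKernel p (combine l π))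
    (hg : ∀ i, (g i).1 = applyKernel f.1 (π i)) : VConvexLE f (PP.mixture l hl hl1 g) := by
  intro φ hφ hconv ⟨K, hK⟩
  have hM : ∀ i, IsMarkovKernel (π i) := fun i => (hπ i).1
  have hMc : IsMarkovKernel (combine l π) := hm.1.1
  have hgi : ∀ i, Integrable φ (g i).1 := fun i => integrable_of_growth hp _ hφ hK
  rw [integral_mixture hl hl1 g hgi]
  have hcomp : ∀ i, Integrable (fun q : Phase d × Vec d => φ (q.1.1, q.2)) (f.1 ⊗ₘ π i) :=
    fun i => by
      have h1 := hgi i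
      rw [hg i, applyKernel, integrable_map_measure hφ.aestronglyMeasurable (by fun_prop)] at h1
      exact h1
  have hfib : ∀ i z, Integrable (fun w => φ (z.1, w)) (π i z) := fun i z => by
    refine ((((integrable_const (1 : ℝ)).add (integrable_const (‖z.1‖ ^ p))).add
      ((hπ i).2 z)).const_mul (K * 4 ^ p)).mono' (by fun_prop) (ae_of_all _ fun w => ?_)
    exact abs_le_of_growth hp hK z.1 w
  have h1 : ∀ z : Phase d, φ z ≤ ∑ i, l i • ∫ w, φ (z.1, w) ∂(π i z) := fun z => by
    have hci : Integrable (fun w => φ (z.1, w)) (combine l π z) :=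
      integrable_finsetSum_measure.2 fun i _ => (hfib i z).smul_measure ENNReal.ofReal_ne_top
    have hci' : Integrable (fun w : Vec d => w) (combine l π z) :=
      integrable_of_rpow hp (by fun_prop) (hm.1.2 z)
    have := (hconv z.1).map_integral_le (μ := combine l π z) (f := fun w => w)
      (by fun_prop) isClosed_univ (by simp) hci' hci
    rw [hm.2 z] at this
    rw [← integral_combine hl fun i => hfib i z]
    exact this
  have h2 : ∀ i, ∫ z, φ z ∂(g i).1 = ∫ z, ∫ w, φ (z.1, w) ∂(π i z) ∂f.1 := fun i => by
    rw [hg i, applyKernel, integral_map (by fun_prop) hφ.aestronglyMeasurable]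
    exact Measure.integral_compProd (hcomp i)
  have hI : ∀ i, Integrable (fun z => l i • ∫ w, φ (z.1, w) ∂(π i z)) f.1 := fun i =>
    (hcomp i).integral_compProd.smul (l i)
  calc ∫ z, φ z ∂f.1 ≤ ∫ z, ∑ i, l i • ∫ w, φ (z.1, w) ∂(π i z) ∂f.1 :=
        integral_mono (integrable_of_growth hp f hφ hK) (integrable_finsetSum _ fun i _ => hI i) h1
    _ = ∑ i, l i * ∫ z, φ z ∂(g i).1 := by
        rw [integral_finsetSum _ fun i _ => hI i]
        refine Finset.sum_congr rfl fun i _ => ?_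
        rw [h2 i]
        exact integral_smul _ _

lemma growth_rel (hp : 1 ≤ p) {c C : ℝ} (hc : 0 ≤ c) {Φ : PP d p → ℝ} (hG : Growth c C Φ) :
    Growth c C (rel Φ) := by
  intro f
  refine ⟨le_csInf ⟨_, self_mem_relaxationValues Φ f⟩ ?_, (rel_le_self hc hG f).trans (hG f).2⟩
  rintro a ⟨N, l, π, g, hl, hl1, hπ, hm, hg, rfl⟩
  refine le_trans ?_ (lower_bound_of_growth hG (fun i => (hl i).1) hl1 g)
  have h1 := mom_le_of_vConvexLE hp (vConvexLE_mixture hp (fun i => (hl i).1) hl1 hπ hm hg)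
  have h2 : mom (PP.mixture l (fun i => (hl i).1) hl1 g) = ∑ i, l i * mom (g i) :=
    integral_mixture (fun i => (hl i).1) hl1 g fun i => (g i).integrable_snd
  rw [pairing_eq, ← h2]
  linarith [mul_le_mul_of_nonneg_left h1 hc]

lemma Growth.mono {c C C' : ℝ} (h : C ≤ C') {Ψ : PP d p → ℝ} (hG : Growth c C Ψ) :
    Growth c C' Ψ := by
  intro f
  have h1 := hG f
  simp only [pairing_eq] at h1 ⊢
  have h2 := mul_le_mul_of_nonneg_right h (mom_nonneg f)
  constructor <;> linarith

lemma integral_mix {t : ℝ} (ht : t ∈ Set.Icc (0 : ℝ) 1) (f g : PP d p) {φ : Phase d → ℝ}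
    (hf : Integrable φ f.1) (hg : Integrable φ g.1) :
    ∫ z, φ z ∂(mix t ht f g).1 = (1 - t) * ∫ z, φ z ∂f.1 + t * ∫ z, φ z ∂g.1 := by
  refine (integral_add_measure (hf.smul_measure ENNReal.ofReal_ne_top)
    (hg.smul_measure ENNReal.ofReal_ne_top)).trans ?_
  rw [integral_smul_measure, integral_smul_measure, ENNReal.toReal_ofReal (by linarith [ht.2]),
    ENNReal.toReal_ofReal ht.1, smul_eq_mul, smul_eq_mul]

/-- The functional `f ↦ ⟨f, -C + c |v|^p⟩` is affine, hence a convex minorant under the growth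
condition. -/
lemma isConvex_pairing (a b : ℝ) : IsConvex (fun f : PP d p => pairing f a b) := by
  intro f g t ht
  have hi : ∀ f : PP d p, Integrable (fun z : Phase d => a + b * ‖z.2‖ ^ p) f.1 := fun f =>
    (integrable_const _).add (f.integrable_snd.const_mul _)
  exact (integral_mix ht f g (hi f) (hi g)).le

section envelopes

variable {c C : ℝ} {Φ Ψ : PP d p → ℝ}

lemma VConvexLE.refl (f : PP d p) : VConvexLE f f := fun _ _ _ _ => le_rfl

lemma VConvexLE.mix (hp : 1 ≤ p) {f f' g g' : PP d p} (h : VConvexLE f g) (h' : VConvexLE f' g')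
    (t : ℝ) (ht : t ∈ Set.Icc (0 : ℝ) 1) :
    VConvexLE (mix t ht f f') (RelaxedAction.mix t ht g g') := by
  intro φ hφ hc ⟨K, hK⟩
  have hi : ∀ f : PP d p, Integrable φ f.1 := fun f => integrable_of_growth hp f hφ hK
  rw [integral_mix ht f f' (hi _) (hi _), integral_mix ht g g' (hi _) (hi _)]
  exact add_le_add (mul_le_mul_of_nonneg_left (h φ hφ hc ⟨K, hK⟩) (by linarith [ht.2]))
    (mul_le_mul_of_nonneg_left (h' φ hφ hc ⟨K, hK⟩) ht.1)

lemma neg_le_of_lower (hc : 0 ≤ c) (hΨ : ∀ g, pairing g (-C) c ≤ Ψ g) (g : PP d p) :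
    -C ≤ Ψ g := by
  have h1 := hΨ g
  rw [pairing_eq] at h1
  linarith [mul_nonneg hc (mom_nonneg g)]

lemma inc_le (hΨ : ∀ g, -C ≤ Ψ g) {f g : PP d p} (h : VConvexLE f g) : inc Ψ f ≤ Ψ g := by
  refine csInf_le ⟨-C, ?_⟩ ⟨g, h, rfl⟩
  rintro a ⟨g', -, rfl⟩
  exact hΨ g'

lemma le_inc {f : PP d p} {a : ℝ} (h : ∀ g, VConvexLE f g → a ≤ Ψ g) : a ≤ inc Ψ f := by
  refine le_csInf ⟨_, f, VConvexLE.refl f, rfl⟩ ?_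
  rintro b ⟨g, hg, rfl⟩
  exact h g hg

lemma exists_lt_of_inc_lt {f : PP d p} {a : ℝ} (h : inc Ψ f < a) :
    ∃ g, VConvexLE f g ∧ Ψ g < a := by
  by_contra! hcon
  exact absurd (le_inc hcon) (not_le.2 h)

lemma isConvex_inc (hp : 1 ≤ p) (hΨ : ∀ g, -C ≤ Ψ g) (hconv : IsConvex Ψ) :
    IsConvex (inc Ψ) := by
  intro f f' t ht
  refine le_of_forall_pos_le_add fun ε hε => ?_
  obtain ⟨g, hg, hlt⟩ := exists_lt_of_inc_lt (lt_add_of_pos_right (inc Ψ f) hε)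
  obtain ⟨g', hg', hlt'⟩ := exists_lt_of_inc_lt (lt_add_of_pos_right (inc Ψ f') hε)
  have h1 := inc_le hΨ (hg.mix hp hg' t ht)
  have h2 := hconv g g' t ht
  have h3 := mul_le_mul_of_nonneg_left hlt.le (by linarith [ht.2] : 0 ≤ 1 - t)
  have h4 := mul_le_mul_of_nonneg_left hlt'.le ht.1
  linarith

lemma le_conv {Θ : PP d p → ℝ} (hΘ : IsConvex Θ) (hle : ∀ g, Θ g ≤ Ψ g) (f : PP d p) :
    Θ f ≤ conv Ψ f := by
  refine le_csSup ⟨Ψ f, ?_⟩ ⟨Θ, hΘ, hle, rfl⟩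
  rintro a ⟨Θ', -, h, rfl⟩
  exact h f

lemma conv_le_of_forall (hΨ : ∀ g, pairing g (-C) c ≤ Ψ g) {f : PP d p} {a : ℝ}
    (h : ∀ Θ : PP d p → ℝ, IsConvex Θ → (∀ g, Θ g ≤ Ψ g) → Θ f ≤ a) : conv Ψ f ≤ a := by
  refine csSup_le ⟨_, _, isConvex_pairing (-C) c, hΨ, rfl⟩ ?_
  rintro b ⟨Θ, h1, h2, rfl⟩
  exact h Θ h1 h2

lemma conv_le (hΨ : ∀ g, pairing g (-C) c ≤ Ψ g) (f : PP d p) : conv Ψ f ≤ Ψ f :=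
  conv_le_of_forall hΨ fun _ _ h => h f

lemma isConvex_conv (hΨ : ∀ g, pairing g (-C) c ≤ Ψ g) : IsConvex (conv Ψ) := by
  intro f g t ht
  refine conv_le_of_forall hΨ fun Θ hΘ hle => (hΘ f g t ht).trans ?_
  exact add_le_add (mul_le_mul_of_nonneg_left (le_conv hΘ hle f) (by linarith [ht.2]))
    (mul_le_mul_of_nonneg_left (le_conv hΘ hle g) ht.1)

lemma IsConvex.conv_eq (hΨ : ∀ g, pairing g (-C) c ≤ Ψ g) (h : IsConvex Ψ) : conv Ψ = Ψ :=
  funext fun f => le_antisymm (conv_le hΨ f) (le_conv h (fun _ => le_rfl) f)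

lemma inc_conv_le_conv_inc (hp : 1 ≤ p) (hc : 0 ≤ c) (hΦ : ∀ g, pairing g (-C) c ≤ Φ g)
    (f : PP d p) : inc (conv Φ) f ≤ conv (inc Φ) f := by
  have h1 := neg_le_of_lower hc fun g => le_conv (isConvex_pairing (-C) c) hΦ g
  refine le_conv (isConvex_inc hp h1 (isConvex_conv hΦ)) (fun g => le_inc fun g' hg' => ?_) f
  exact (inc_le h1 hg').trans (conv_le hΦ g')

lemma inc_conv_le_rel (hp : 1 ≤ p) (hc : 0 ≤ c) (hΦ : ∀ g, pairing g (-C) c ≤ Φ g)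
    (f : PP d p) : inc (conv Φ) f ≤ rel Φ f := by
  have h1 := neg_le_of_lower hc fun g => le_conv (isConvex_pairing (-C) c) hΦ g
  refine le_csInf ⟨_, self_mem_relaxationValues Φ f⟩ ?_
  rintro a ⟨N, l, π, g, hl, hl1, hπ, hm, hg, rfl⟩
  refine (inc_le h1 (vConvexLE_mixture hp (fun i => (hl i).1) hl1 hπ hm hg)).trans
    (((isConvex_conv hΦ).map_mixture_le _ _ _ _).trans ?_)
  exact Finset.sum_le_sum fun i _ => mul_le_mul_of_nonneg_left (conv_le hΦ _) (hl i).1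

end envelopes

/-! ### Splitting a measure with prescribed masses and barycentres -/

open Filter Topology in
/-- A continuous linear map on a Hilbert space sends bounded closed convex sets to closed sets. For
`y` in the closure of the image, the points of minimal norm of `S ∩ L⁻¹(B(y, 1/(n+1)))` form a
Cauchy sequence by the parallelogram identity. -/
lemma isClosed_image_of_isBounded {H E : Type*} [NormedAddCommGroup H] [InnerProductSpace ℝ H]
    [CompleteSpace H] [NormedAddCommGroup E] [NormedSpace ℝ E] (L : H →L[ℝ] E) {S : Set H}
    (hS : IsClosed S) (hconv : Convex ℝ S) {B : ℝ} (hB : ∀ θ ∈ S, ‖θ‖ ≤ B) :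
    IsClosed (L '' S) := by
  refine isClosed_of_closure_subset fun y hy => ?_
  set K : ℕ → Set H := fun n => S ∩ L ⁻¹' Metric.closedBall y (1 / ((n : ℝ) + 1)) with hK
  have hKanti : ∀ {n m : ℕ}, n ≤ m → K m ⊆ K n := fun {n m} hnm θ hθ =>
    ⟨hθ.1, Metric.closedBall_subset_closedBall (one_div_le_one_div_of_le (by positivity)
      (by exact_mod_cast Nat.succ_le_succ hnm)) hθ.2⟩
  have hKconv : ∀ n, Convex ℝ (K n) := fun n =>
    hconv.inter ((convex_closedBall y _).linear_preimage L.toLinearMap)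
  have hKmin : ∀ n, ∃ u ∈ K n, ∀ w ∈ K n, ‖u‖ ≤ ‖w‖ := fun n => by
    have hne : (K n).Nonempty := by
      obtain ⟨_, ⟨θ, hθ, rfl⟩, hd⟩ := Metric.mem_closure_iff.1 hy (1 / ((n : ℝ) + 1))
        (by positivity)
      exact ⟨θ, hθ, by rw [Set.mem_preimage, Metric.mem_closedBall, dist_comm]; exact hd.le⟩
    have hcl : IsClosed (K n) := hS.inter (Metric.isClosed_closedBall.preimage L.continuous)
    obtain ⟨u, hu, hmin⟩ := exists_norm_eq_iInf_of_complete_convex hne hcl.isComplete (hKconv n) 0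
    refine ⟨u, hu, fun w hw => ?_⟩
    have h1 : (⨅ w : K n, ‖(0 : H) - w‖) ≤ ‖(0 : H) - w‖ :=
      ciInf_le ⟨0, by rintro _ ⟨w, rfl⟩; exact norm_nonneg _⟩ (⟨w, hw⟩ : K n)
    rw [← hmin] at h1
    simpa using h1
  choose u hu hmin using hKmin
  have hmono : Monotone fun n => ‖u n‖ ^ 2 := fun n m hnm =>
    pow_le_pow_left₀ (norm_nonneg _) (hmin n _ (hKanti hnm (hu m))) 2
  have hbdd : BddAbove (Set.range fun n => ‖u n‖ ^ 2) := by
    refine ⟨B ^ 2, ?_⟩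
    rintro _ ⟨n, rfl⟩
    exact pow_le_pow_left₀ (norm_nonneg _) (hB _ (hu n).1) 2
  have hpar : ∀ {n m : ℕ}, n ≤ m → ‖u n - u m‖ ^ 2 ≤ 2 * (‖u m‖ ^ 2 - ‖u n‖ ^ 2) :=
    fun {n m} hnm => by
      have h1 : ‖u n‖ ≤ ‖(1 / 2 : ℝ) • u n + (1 / 2 : ℝ) • u m‖ :=
        hmin n _ (hKconv n (hu n) (hKanti hnm (hu m)) (by norm_num) (by norm_num) (by norm_num))
      rw [← smul_add, norm_smul, Real.norm_of_nonneg (by norm_num)] at h1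
      have h2 := parallelogram_law_with_norm ℝ (u n) (u m)
      nlinarith [norm_nonneg (u n), norm_nonneg (u n + u m)]
  have hcauchy : CauchySeq u := by
    have hc := (tendsto_atTop_ciSup hmono hbdd).cauchySeq
    refine Metric.cauchySeq_iff'.2 fun ε hε => ?_
    obtain ⟨N, hN⟩ := Metric.cauchySeq_iff'.1 hc (ε ^ 2 / 2) (by positivity)
    refine ⟨N, fun n hn => ?_⟩
    have h1 := hpar hn
    have h2 := hN n hn
    rw [Real.dist_eq] at h2
    have h3 := (abs_lt.1 h2).2
    rw [dist_comm, dist_eq_norm]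
    refine lt_of_pow_lt_pow_left₀ 2 hε.le ?_
    linarith
  obtain ⟨x, hx⟩ := cauchySeq_tendsto_of_complete hcauchy
  refine ⟨x, hS.mem_of_tendsto hx (Eventually.of_forall fun n => (hu n).1), ?_⟩
  refine tendsto_nhds_unique ((L.continuous.tendsto x).comp hx) ?_
  refine tendsto_iff_dist_tendsto_zero.2 (squeeze_zero (fun _ => dist_nonneg)
    (fun n => Metric.mem_closedBall.1 (hu n).2) tendsto_one_div_add_atTop_nhds_zero_nat)

/-- The pointwise maximum of finitely many functions is attained by a measurable partition of unity:
the weights are uniform on the set of maximizing indices. -/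
lemma exists_weights_eq_sup' {Ω J : Type*} [MeasurableSpace Ω] [Fintype J] [Nonempty J]
    {h : J → Ω → ℝ} (hh : ∀ j, Measurable (h j)) :
    ∃ θ : J → Ω → ℝ, (∀ j, Measurable (θ j)) ∧ (∀ j ω, 0 ≤ θ j ω) ∧ (∀ ω, ∑ j, θ j ω = 1) ∧
      ∀ ω, ∑ j, θ j ω * h j ω = Finset.univ.sup' Finset.univ_nonempty fun j => h j ω := by
  classical
  set M : Ω → ℝ := fun ω => Finset.univ.sup' Finset.univ_nonempty fun j => h j ω with hM
  have hMm : Measurable M := by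
    have := Finset.measurable_sup' (Finset.univ_nonempty (α := J)) (f := h) fun j _ => hh j
    convert this using 1
    ext ω
    simp [hM]
  set χ : J → Ω → ℝ := fun j => {ω | h j ω = M ω}.indicator fun _ => 1 with hχ
  have hχm : ∀ j, Measurable (χ j) := fun j =>
    measurable_const.indicator (measurableSet_eq_fun (hh j) hMm)
  have hχ0 : ∀ j ω, 0 ≤ χ j ω := fun j ω => Set.indicator_nonneg (fun _ _ => zero_le_one) ω
  have hpos : ∀ ω, 0 < ∑ j, χ j ω := fun ω => by
    obtain ⟨j, -, hj⟩ := Finset.exists_mem_eq_sup' (Finset.univ_nonempty (α := J)) fun j => h j ω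
    refine Finset.sum_pos' (fun j _ => hχ0 j ω) ⟨j, Finset.mem_univ _, ?_⟩
    have hmem : ω ∈ {ω | h j ω = M ω} := hj.symm
    have : χ j ω = 1 := Set.indicator_of_mem hmem _
    rw [this]
    exact one_pos
  have hχh : ∀ j ω, χ j ω * h j ω = χ j ω * M ω := fun j ω => by
    by_cases hj : h j ω = M ω
    · rw [hj]
    · have hnot : ω ∉ {ω | h j ω = M ω} := hj
      have : χ j ω = 0 := Set.indicator_of_notMem hnot _
      rw [this, zero_mul, zero_mul]
  refine ⟨fun j ω => χ j ω / ∑ i, χ i ω, fun j => by fun_prop,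
    fun j ω => div_nonneg (hχ0 j ω) (hpos ω).le, fun ω => ?_, fun ω => ?_⟩
  · rw [← Finset.sum_div, div_self (hpos ω).ne']
  · simp only [div_mul_eq_mul_div, hχh]
    rw [← Finset.sum_div, ← Finset.sum_mul, mul_div_right_comm, div_self (hpos ω).ne', one_mul]

open scoped InnerProductSpace in
/-- The moment vectors `(∫ θ j * u a)` of all partitions of unity `θ` form a closed convex set. By
the Hahn-Banach theorem it contains every `T` that is bounded by its support function, which is
`ℓ ↦ ∫ max_j ∑ a, ℓ j a * u a`. -/
lemma exists_partition_of_memLp {Ω J A : Type*} [MeasurableSpace Ω] [Fintype J] [Nonempty J]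
    [Fintype A] {ν : Measure Ω} [IsFiniteMeasure ν] {u : A → Ω → ℝ} (hum : ∀ a, Measurable (u a))
    (hu : ∀ a, MemLp (u a) 2 ν) (T : J → A → ℝ)
    (hT : ∀ ℓ : J → A → ℝ, ∑ j, ∑ a, ℓ j a * T j a ≤
      ∫ ω, Finset.univ.sup' Finset.univ_nonempty (fun j => ∑ a, ℓ j a * u a ω) ∂ν) :
    ∃ θ : J → Ω → ℝ, (∀ j, Measurable (θ j)) ∧ (∀ j, 0 ≤ᵐ[ν] θ j) ∧
      (∀ᵐ ω ∂ν, ∑ j, θ j ω = 1) ∧ ∀ j a, ∫ ω, θ j ω * u a ω ∂ν = T j a := by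
  classical
  set one : Lp ℝ 2 ν := (memLp_const (1 : ℝ)).toLp _ with hone
  have hone_ae : ⇑one =ᵐ[ν] fun _ => 1 := MemLp.coeFn_toLp _
  -- partitions of unity up to null sets, as a subset of the Hilbert space `L²(ν)^J`
  set S : Set (PiLp 2 fun _ : J => Lp ℝ 2 ν) := {θ | (∀ j, 0 ≤ θ j) ∧ ∑ j, θ j = one} with hS
  set U : A → Lp ℝ 2 ν := fun a => (hu a).toLp _ with hU
  set L : (PiLp 2 fun _ : J => Lp ℝ 2 ν) →L[ℝ] (J × A → ℝ) :=
    ContinuousLinearMap.pi fun ja => (innerSL ℝ (U ja.2)).comp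
      (PiLp.proj 2 (fun _ : J => Lp ℝ 2 ν) ja.1) with hL
  have hLapp : ∀ θ ja, L θ ja = ∫ ω, θ ja.1 ω * u ja.2 ω ∂ν := fun θ ja => by
    change ⟪U ja.2, θ ja.1⟫_ℝ = _
    rw [L2.inner_def]
    refine integral_congr_ae ?_
    filter_upwards [(hu ja.2).coeFn_toLp] with ω hω
    rw [hU, hω]
    simp
  have hev : ∀ j, Continuous fun θ : PiLp 2 fun _ : J => Lp ℝ 2 ν => θ j := fun j =>
    PiLp.continuous_apply 2 (fun _ : J => Lp ℝ 2 ν) j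
  have hsmul : ∀ (a : ℝ) (θ : Lp ℝ 2 ν), 0 ≤ a → 0 ≤ θ → 0 ≤ a • θ := fun a θ ha hθ => by
    rw [← Lp.coeFn_nonneg] at hθ ⊢
    filter_upwards [hθ, Lp.coeFn_smul a θ] with ω h1 h2
    rw [h2]
    exact mul_nonneg ha h1
  have hcl : IsClosed S := by
    refine IsClosed.inter ?_ ?_
    · have h1 : IsClosed (⋂ j, {θ : PiLp 2 fun _ : J => Lp ℝ 2 ν | 0 ≤ θ j}) :=
        isClosed_iInter fun j => isClosed_le continuous_const (hev j)
      rwa [← Set.ofPred_forall] at h1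
    · exact isClosed_eq (continuous_finsetSum _ fun j _ => hev j) continuous_const
  have hconv : Convex ℝ S := by
    intro θ hθ η hη a b ha hb hab
    refine ⟨fun j => ?_, ?_⟩
    · change 0 ≤ a • θ j + b • η j
      exact add_nonneg (hsmul a _ ha (hθ.1 j)) (hsmul b _ hb (hη.1 j))
    · change ∑ j, (a • θ j + b • η j) = one
      rw [Finset.sum_add_distrib, ← Finset.smul_sum, ← Finset.smul_sum, hθ.2, hη.2, ← add_smul,
        hab, one_smul]
  have hbdd : ∀ θ ∈ S, ‖θ‖ ≤ Real.sqrt (∑ _j : J, ‖one‖ ^ 2) := fun θ hθ => by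
    refine Real.le_sqrt_of_sq_le ?_
    rw [PiLp.norm_sq_eq_of_L2]
    refine Finset.sum_le_sum fun j _ => pow_le_pow_left₀ (norm_nonneg _) ?_ 2
    have h1 : θ j ≤ one := by
      rw [← hθ.2]
      exact Finset.single_le_sum (fun i _ => hθ.1 i) (Finset.mem_univ j)
    refine norm_le_norm_of_abs_le_abs ?_
    rwa [abs_of_nonneg (hθ.1 j), abs_of_nonneg ((hθ.1 j).trans h1)]
  have himg : IsClosed (L '' S) := isClosed_image_of_isBounded L hcl hconv hbdd
  have hmem : (fun ja : J × A => T ja.1 ja.2) ∈ L '' S := by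
    by_contra hnot
    obtain ⟨F, r, hF1, hF2⟩ := geometric_hahn_banach_closed_point
      (hconv.linear_image L.toLinearMap) himg hnot
    set ℓ : J → A → ℝ := fun j a => F (Pi.single (j, a) 1) with hℓ
    have hF : ∀ y : J × A → ℝ, F y = ∑ j, ∑ a, ℓ j a * y (j, a) := fun y => by
      have := LinearMap.pi_apply_eq_sum_univ F.toLinearMap y
      rw [← Fintype.sum_prod_type' (f := fun j a => ℓ j a * y (j, a))]
      refine this.trans (Finset.sum_congr rfl fun ja _ => ?_)
      rw [smul_eq_mul, mul_comm]
      congr 1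
      refine congrArg F (funext fun i => ?_)
      simp [Pi.single_apply, eq_comm]
    -- this partition of unity attains the maximum of the separating functional over the image
    obtain ⟨θ, hθm, hθ0, hθ1, hθs⟩ := exists_weights_eq_sup'
      (h := fun j ω => ∑ a, ℓ j a * u a ω) fun j => by fun_prop
    have hθle : ∀ j ω, θ j ω ≤ 1 := fun j ω => by
      rw [← hθ1 ω]
      exact Finset.single_le_sum (fun i _ => hθ0 i ω) (Finset.mem_univ j)
    have hθL : ∀ j, MemLp (θ j) 2 ν := fun j =>
      MemLp.of_bound (hθm j).aestronglyMeasurable 1 (ae_of_all _ fun ω => by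
        rw [Real.norm_of_nonneg (hθ0 j ω)]; exact hθle j ω)
    set Θ : PiLp 2 fun _ : J => Lp ℝ 2 ν := WithLp.toLp 2 fun j => (hθL j).toLp _ with hΘ
    have hΘj : ∀ j, ⇑(Θ j) =ᵐ[ν] θ j := fun j => (hθL j).coeFn_toLp
    have hΘS : Θ ∈ S := by
      refine ⟨fun j => ?_, ?_⟩
      · rw [← Lp.coeFn_nonneg]
        filter_upwards [hΘj j] with ω hω
        rw [hω]
        exact hθ0 j ω
      · refine Lp.ext ?_
        have h1 : ⇑(∑ j, Θ j) =ᵐ[ν] ∑ j, ⇑(Θ j) := Lp.coeFn_finsetSum _ _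
        have h2 : ∀ᵐ ω ∂ν, ∀ j, Θ j ω = θ j ω := ae_all_iff.2 hΘj
        filter_upwards [h1, h2, hone_ae] with ω e1 e2 e3
        rw [e1, e3, Finset.sum_apply]
        simp only [e2, hθ1]
    have h1 := hF1 _ ⟨Θ, hΘS, rfl⟩
    have h2 := hT ℓ
    rw [hF] at h1 hF2
    have hint : ∀ j a, Integrable (fun ω => θ j ω * u a ω) ν := fun j a =>
      (hθL j).integrable_mul (hu a)
    have hint' : ∀ j a, Integrable (fun ω => θ j ω * (ℓ j a * u a ω)) ν := fun j a => by
      refine ((hint j a).const_mul (ℓ j a)).congr (ae_of_all _ fun ω => ?_)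
      simp only
      ring
    have h3 : ∑ j, ∑ a, ℓ j a * L Θ (j, a) =
        ∫ ω, Finset.univ.sup' Finset.univ_nonempty (fun j => ∑ a, ℓ j a * u a ω) ∂ν := by
      simp only [← hθs, Finset.mul_sum]
      rw [integral_finsetSum _ fun j _ => integrable_finsetSum _ fun a _ => hint' j a]
      refine Finset.sum_congr rfl fun j _ => ?_
      rw [integral_finsetSum _ fun a _ => hint' j a]
      refine Finset.sum_congr rfl fun a _ => ?_
      rw [hLapp, ← integral_const_mul]
      refine integral_congr_ae ?_
      filter_upwards [hΘj j] with ω hω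
      simp only [hω]
      ring
    change ∑ j, ∑ a, ℓ j a * L Θ (j, a) < r at h1
    rw [h3] at h1
    linarith
  obtain ⟨θ, hθ, hLθ⟩ := hmem
  refine ⟨fun j => θ j, fun j => (Lp.stronglyMeasurable _).measurable,
    fun j => (Lp.coeFn_nonneg _).2 (hθ.1 j), ?_, fun j a => ?_⟩
  · have h1 : ⇑(∑ j, θ j) =ᵐ[ν] ∑ j, ⇑(θ j) := Lp.coeFn_finsetSum _ _
    rw [hθ.2] at h1
    filter_upwards [h1, hone_ae] with ω e1 e2
    rw [← Finset.sum_apply, ← e1, e2]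
  · rw [← hLapp θ (j, a), hLθ]

/-- If the functions `u a` are integrable and the targets `T j a` satisfy the support function
inequality, then `ν` splits into measures `ν' j` with moments `∫ u a ∂(ν' j) = T j a`. -/
lemma exists_measure_decomposition {Ω J A : Type*} [MeasurableSpace Ω] [Fintype J] [Nonempty J]
    [Fintype A] {ν : Measure Ω} [IsFiniteMeasure ν] {u : A → Ω → ℝ} (hum : ∀ a, Measurable (u a))
    (hu : ∀ a, Integrable (u a) ν) (T : J → A → ℝ)
    (hT : ∀ ℓ : J → A → ℝ, ∑ j, ∑ a, ℓ j a * T j a ≤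
      ∫ ω, Finset.univ.sup' Finset.univ_nonempty (fun j => ∑ a, ℓ j a * u a ω) ∂ν) :
    ∃ ν' : J → Measure Ω, ∑ j, ν' j = ν ∧ ∀ j a, ∫ ω, u a ω ∂(ν' j) = T j a := by
  -- with respect to the measure `ρ ν` the functions `u a / ρ` are bounded, hence in `L²`
  set ρ : Ω → ℝ := fun ω => 1 + ∑ a, |u a ω| with hρ
  have hρm : Measurable ρ := by
    have : ∀ a, Measurable fun ω => |u a ω| := fun a => (hum a).abs
    fun_prop
  have hρ1 : ∀ ω, 1 ≤ ρ ω := fun ω =>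
    le_add_of_nonneg_right (Finset.sum_nonneg fun a _ => abs_nonneg _)
  have hρ0 : ∀ ω, 0 < ρ ω := fun ω => one_pos.trans_le (hρ1 ω)
  have hρi : Integrable ρ ν :=
    (integrable_const _).add (integrable_finsetSum _ fun a _ => (hu a).abs)
  set μ := ν.withDensity fun ω => ENNReal.ofReal (ρ ω) with hμ
  have : IsFiniteMeasure μ := isFiniteMeasure_withDensity_ofReal hρi.2
  have hint : ∀ F : Ω → ℝ, ∫ ω, F ω ∂μ = ∫ ω, ρ ω * F ω ∂ν := fun F => by
    rw [hμ, integral_withDensity_eq_integral_toReal_smul (by fun_prop)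
      (ae_of_all _ fun _ => ENNReal.ofReal_lt_top)]
    simp only [ENNReal.toReal_ofReal (hρ0 _).le, smul_eq_mul]
  have hac : ν ≪ μ := withDensity_absolutelyContinuous' (by fun_prop)
    (ae_of_all _ fun ω => by simpa using hρ0 ω)
  have hbd : ∀ a ω, |u a ω / ρ ω| ≤ 1 := fun a ω => by
    rw [abs_div, abs_of_pos (hρ0 ω), div_le_one (hρ0 ω)]
    have := Finset.single_le_sum (f := fun a => |u a ω|) (fun a _ => abs_nonneg _)
      (Finset.mem_univ a)
    simp only [hρ]
    linarith
  obtain ⟨θ, hθm, hθ0, hθ1, hθT⟩ := exists_partition_of_memLp (ν := μ)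
    (u := fun a ω => u a ω / ρ ω) (fun a => by fun_prop)
    (fun a => MemLp.of_bound ((hum a).div hρm).aestronglyMeasurable 1 (ae_of_all _ (hbd a))) T fun ℓ => by
      refine (hT ℓ).trans_eq ?_
      rw [hint]
      refine integral_congr_ae (ae_of_all _ fun ω => ?_)
      simp only
      rw [Finset.mul₀_sup' (hρ0 ω).le]
      congr 1
      ext j
      rw [Finset.mul_sum]
      refine Finset.sum_congr rfl fun a _ => ?_
      have := (hρ0 ω).ne'
      field_simp
  have hθm' : ∀ j, Measurable fun ω => ENNReal.ofReal (θ j ω) := fun j => (hθm j).ennreal_ofReal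
  have hθ0' : ∀ᵐ ω ∂ν, ∀ j, 0 ≤ θ j ω := ae_all_iff.2 fun j => hac.ae_le (hθ0 j)
  refine ⟨fun j => ν.withDensity fun ω => ENNReal.ofReal (θ j ω), ?_, fun j a => ?_⟩
  · ext s hs
    simp only [Measure.coe_finsetSum, Finset.sum_apply, withDensity_apply _ hs]
    rw [← lintegral_finsetSum _ fun j _ => hθm' j, ← setLIntegral_one]
    refine setLIntegral_congr_fun_ae hs ?_
    filter_upwards [hθ0', hac.ae_le hθ1] with ω h0 h1 _
    rw [← ENNReal.ofReal_sum_of_nonneg fun j _ => h0 j, h1, ENNReal.ofReal_one]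
  · rw [← hθT j a, hint, integral_withDensity_eq_integral_toReal_smul (hθm' j)
      (ae_of_all _ fun _ => ENNReal.ofReal_lt_top)]
    refine integral_congr_ae ?_
    filter_upwards [hθ0'] with ω h0
    rw [ENNReal.toReal_ofReal (h0 j), smul_eq_mul]
    have := (hρ0 ω).ne'
    field_simp

/-! ### Matching decompositions of ordered measures -/

/-- A finite continuous partition of unity subordinate to small balls covering the ball of radius
`R` around `0`, together with one function supported outside that ball. -/
lemma exists_partition_of_unity (d : ℕ) (hp : 1 ≤ p) {ε : ℝ} (hε : 0 < ε) (R : ℝ) :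
    ∃ (ι : Type) (_ : Fintype ι) (χ : ι → Vec d → ℝ) (y : ι → Vec d),
      (∀ k, Continuous (χ k)) ∧ (∀ k x, 0 ≤ χ k x) ∧ (∀ x, ∑ k, χ k x = 1) ∧
      ∀ x, ∑ k, χ k x * ‖x - y k‖ ^ p ≤ ε + {x : Vec d | R < ‖x‖}.indicator (‖·‖ ^ p) x := by
  have hp0 : 0 < p := by linarith
  set ρ : ℝ := ε ^ (1 / p) with hρ
  have hρ0 : 0 < ρ := by positivity
  have hρp : ρ ^ p = ε := by
    rw [hρ, ← Real.rpow_mul hε.le, one_div_mul_cancel hp0.ne', Real.rpow_one]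
  obtain ⟨t, htf, hcov⟩ := Metric.totallyBounded_iff.1
    (isCompact_closedBall (0 : Vec d) R).totallyBounded ρ hρ0
  have := htf.fintype
  set y : Option t → Vec d := fun k => k.elim 0 (↑) with hy
  set h : Option t → Vec d → ℝ := fun k x =>
    k.elim (max 0 (‖x‖ - R)) fun a => max 0 (ρ - ‖x - a‖) with hh
  have hh0 : ∀ k x, 0 ≤ h k x := fun k x => by cases k <;> exact le_max_left _ _
  have hhc : ∀ k, Continuous (h k) := fun k => by
    cases k <;> simp only [hh, Option.elim] <;> fun_prop
  have hpos : ∀ x, 0 < ∑ k, h k x := fun x => by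
    by_cases hx : ‖x‖ ≤ R
    · obtain ⟨a, ha, hxa⟩ := Set.mem_iUnion₂.1 (hcov (mem_closedBall_zero_iff.2 hx))
      refine Finset.sum_pos' (fun k _ => hh0 k x) ⟨some ⟨a, ha⟩, Finset.mem_univ _, ?_⟩
      rw [Metric.mem_ball, dist_eq_norm] at hxa
      exact lt_max_of_lt_right (sub_pos.2 hxa)
    · exact Finset.sum_pos' (fun k _ => hh0 k x)
        ⟨none, Finset.mem_univ _, lt_max_of_lt_right (by linarith)⟩
  have hsum : ∀ x, ∑ k, h k x / ∑ i, h i x = 1 := fun x => by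
    rw [← Finset.sum_div, div_self (hpos x).ne']
  have hnn : ∀ k x, 0 ≤ h k x / ∑ i, h i x := fun k x => div_nonneg (hh0 k x) (hpos x).le
  refine ⟨Option t, inferInstance, fun k x => h k x / ∑ i, h i x, y, fun k => ?_, hnn, hsum,
    fun x => ?_⟩
  · exact (hhc k).div (continuous_finsetSum _ fun i _ => hhc i) fun x => (hpos x).ne'
  · have hind : 0 ≤ {x : Vec d | R < ‖x‖}.indicator (‖·‖ ^ p) x :=
      Set.indicator_nonneg (fun _ _ => by positivity) x
    have key : ∀ k, h k x / (∑ i, h i x) * ‖x - y k‖ ^ p ≤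
        h k x / (∑ i, h i x) * (ε + {x : Vec d | R < ‖x‖}.indicator (‖·‖ ^ p) x) := fun k => by
      rcases (hh0 k x).eq_or_lt with h0 | h0
      · rw [← h0]; simp
      · refine mul_le_mul_of_nonneg_left ?_ (hnn k x)
        cases k with
        | none =>
          have hx : R < ‖x‖ := by
            by_contra hcon
            have : h none x = 0 := max_eq_left (by linarith)
            linarith
          have hmem : x ∈ {x : Vec d | R < ‖x‖} := hx
          rw [Set.indicator_of_mem hmem]
          simp only [hy, Option.elim, sub_zero]
          linarith
        | some a =>
          have hx : ‖x - a‖ < ρ := by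
            by_contra hcon
            have : h (some a) x = 0 := max_eq_left (by linarith)
            linarith
          have h1 : ‖x - a‖ ^ p ≤ ρ ^ p := Real.rpow_le_rpow (norm_nonneg _) hx.le hp0.le
          rw [hρp] at h1
          simp only [hy, Option.elim]
          linarith
    refine (Finset.sum_le_sum fun k _ => key k).trans_eq ?_
    rw [← Finset.sum_mul, hsum, one_mul]

lemma withDensity_ofReal_integral {α E : Type*} [MeasurableSpace α] [NormedAddCommGroup E]
    [NormedSpace ℝ E] (μ : Measure α) {w : α → ℝ} (hw : Measurable w) (hw0 : ∀ a, 0 ≤ w a)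
    (F : α → E) :
    ∫ a, F a ∂(μ.withDensity fun a => ENNReal.ofReal (w a)) = ∫ a, w a • F a ∂μ := by
  rw [integral_withDensity_eq_integral_toReal_smul hw.ennreal_ofReal
    (ae_of_all _ fun _ => ENNReal.ofReal_lt_top)]
  simp only [ENNReal.toReal_ofReal (hw0 _)]

lemma withDensity_ofReal_le {α : Type*} [MeasurableSpace α] (μ : Measure α) {w : α → ℝ}
    (hw1 : ∀ a, w a ≤ 1) : (μ.withDensity fun a => ENNReal.ofReal (w a)) ≤ μ := by
  refine (withDensity_mono (ae_of_all _ fun a => ?_)).trans_eq withDensity_one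
  exact ENNReal.ofReal_le_one.2 (hw1 a)

/-- Test functions of the form `χ(x) max_j (a_j + b_j · v)` suffice to split the part `χ(x) g` of
`g` into pieces with the masses and mean velocities of the pieces `χ(x) η_j(v) f` of `f`. -/
lemma VConvexLE.exists_decomposition (hp : 1 ≤ p) {f g : PP d p} (h : VConvexLE f g)
    {J : Type*} [Fintype J] [Nonempty J] {χ : Vec d → ℝ} (hχ : Continuous χ) (hχ0 : ∀ x, 0 ≤ χ x)
    (hχ1 : ∀ x, χ x ≤ 1) {η : J → Vec d → ℝ} (hη : ∀ j, Continuous (η j))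
    (hη0 : ∀ j v, 0 ≤ η j v) (hη1 : ∀ v, ∑ j, η j v = 1) :
    ∃ ν : J → Measure (Phase d),
      ∑ j, ν j = g.1.withDensity (fun z => ENNReal.ofReal (χ z.1)) ∧ ∀ j,
        ν j Set.univ =
          f.1.withDensity (fun z => ENNReal.ofReal (χ z.1 * η j z.2)) Set.univ ∧
        ∫ z, z.2 ∂(ν j) =
          ∫ z, z.2 ∂(f.1.withDensity fun z => ENNReal.ofReal (χ z.1 * η j z.2)) := by
  have hηle : ∀ j v, η j v ≤ 1 := fun j v => by
    rw [← hη1 v]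
    exact Finset.single_le_sum (fun i _ => hη0 i v) (Finset.mem_univ j)
  set μ : J → Measure (Phase d) := fun j =>
    f.1.withDensity fun z => ENNReal.ofReal (χ z.1 * η j z.2) with hμ
  set G : Measure (Phase d) := g.1.withDensity fun z => ENNReal.ofReal (χ z.1) with hG
  have hGle : G ≤ g.1 := withDensity_ofReal_le _ fun z => hχ1 z.1
  have hμle : ∀ j, μ j ≤ f.1 := fun j =>
    withDensity_ofReal_le _ fun z => mul_le_one₀ (hχ1 _) (hη0 _ _) (hηle _ _)
  have : IsFiniteMeasure G := isFiniteMeasure_of_le _ hGle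
  have hμf : ∀ j, IsFiniteMeasure (μ j) := fun j => isFiniteMeasure_of_le _ (hμle j)
  -- the moments of `1` and of the coordinates of `v` encode mass and mean velocity
  set u : Option (Fin d) → Phase d → ℝ := fun a z => a.elim 1 fun i => z.2 i with hu
  have huc : ∀ a, Continuous (u a) := fun a => by
    cases a <;> simp only [hu, Option.elim] <;> fun_prop
  have hule : ∀ a z, |u a z| ≤ 1 + ‖z.2‖ := fun a z => by
    cases a with
    | none => simp [hu]
    | some i =>
      have := PiLp.norm_apply_le z.2 i
      rw [Real.norm_eq_abs] at this
      simp only [hu, Option.elim]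
      linarith
  have hvi : ∀ f : PP d p, Integrable (fun z : Phase d => z.2) f.1 := fun f =>
    integrable_of_rpow hp (by fun_prop) f.integrable_snd
  have hui : ∀ (f : PP d p) a, Integrable (u a) f.1 := fun f a =>
    ((integrable_const (1 : ℝ)).add (hvi f).norm).mono' (huc a).aestronglyMeasurable
      (ae_of_all _ fun z => hule a z)
  obtain ⟨ν, hν, hνT⟩ := exists_measure_decomposition (ν := G) (u := u)
    (fun a => (huc a).measurable) (fun a => (hui g a).mono_measure hGle)
    (fun j a => ∫ z, u a z ∂(μ j)) fun ℓ => by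
      set M : Phase d → ℝ := fun z => Finset.univ.sup' Finset.univ_nonempty
        fun j => ∑ a, ℓ j a * u a z with hM
      have hMc : Continuous M :=
        Continuous.finset_sup'_apply _ fun j _ => by fun_prop
      have hMge : ∀ j z, ∑ a, ℓ j a * u a z ≤ M z := fun j z =>
        Finset.le_sup' (fun j => ∑ a, ℓ j a * u a z) (Finset.mem_univ j)
      have hMabs : ∀ z, |M z| ≤ (∑ j, ∑ a, |ℓ j a|) * (1 + ‖z.2‖) := fun z => by
        obtain ⟨j, -, hj⟩ := Finset.exists_mem_eq_sup' (Finset.univ_nonempty (α := J))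
          fun j => ∑ a, ℓ j a * u a z
        have h1 : M z = ∑ a, ℓ j a * u a z := hj
        rw [h1]
        refine (Finset.abs_sum_le_sum_abs _ _).trans ?_
        have h2 : ∑ a, |ℓ j a * u a z| ≤ ∑ a, |ℓ j a| * (1 + ‖z.2‖) :=
          Finset.sum_le_sum fun a _ => by
            rw [abs_mul]
            exact mul_le_mul_of_nonneg_left (hule a z) (abs_nonneg _)
        refine h2.trans ?_
        rw [← Finset.sum_mul]
        exact mul_le_mul_of_nonneg_right (Finset.single_le_sum (f := fun j => ∑ a, |ℓ j a|)
          (fun j _ => Finset.sum_nonneg fun a _ => abs_nonneg _) (Finset.mem_univ j))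
          (by positivity)
      -- the test function for the order: convex in `v` because `χ ≥ 0` and `M` is max-affine
      set φ : Phase d → ℝ := fun z => χ z.1 * M z with hφ
      have hφc : Continuous φ := (hχ.comp continuous_fst).mul hMc
      have hφK : ∀ x v, |φ (x, v)| ≤ (∑ j, ∑ a, |ℓ j a|) * (1 + ‖x‖ + ‖v‖) ^ p :=
        fun x v => by
          have hL : 0 ≤ ∑ j, ∑ a, |ℓ j a| :=
            Finset.sum_nonneg fun j _ => Finset.sum_nonneg fun a _ => abs_nonneg _
          have hb : 1 + ‖v‖ ≤ (1 + ‖x‖ + ‖v‖) ^ p := by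
            have h1 := Real.self_le_rpow_of_one_le (x := 1 + ‖x‖ + ‖v‖)
              (by linarith [norm_nonneg x, norm_nonneg v]) hp
            linarith [norm_nonneg x]
          rw [hφ, abs_mul, abs_of_nonneg (hχ0 _)]
          calc χ x * |M (x, v)| ≤ 1 * |M (x, v)| :=
                mul_le_mul_of_nonneg_right (hχ1 x) (abs_nonneg _)
            _ ≤ (∑ j, ∑ a, |ℓ j a|) * (1 + ‖v‖) := by rw [one_mul]; exact hMabs (x, v)
            _ ≤ _ := mul_le_mul_of_nonneg_left hb hL
      have hφconv : ∀ x, ConvexOn ℝ Set.univ fun v => φ (x, v) := fun x => by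
        refine ConvexOn.smul (hχ0 x) ⟨convex_univ, fun v _ w _ a b ha hb hab => ?_⟩
        refine Finset.sup'_le _ _ fun j _ => ?_
        have hue : ∀ i, u i (x, a • v + b • w) = a * u i (x, v) + b * u i (x, w) := fun i => by
          cases i with
          | none => simp [hu, hab]
          | some i => simp [hu]
        have h1 : ∑ i, ℓ j i * u i (x, a • v + b • w) =
            a * ∑ i, ℓ j i * u i (x, v) + b * ∑ i, ℓ j i * u i (x, w) := by
          simp only [hue, mul_add, Finset.sum_add_distrib, Finset.mul_sum]
          congr 1 <;> exact Finset.sum_congr rfl fun i _ => by ring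
        rw [h1]
        exact add_le_add (mul_le_mul_of_nonneg_left (hMge j _) ha)
          (mul_le_mul_of_nonneg_left (hMge j _) hb)
      have hint : ∀ j a, Integrable (fun z => χ z.1 * η j z.2 * u a z) f.1 := fun j a => by
        refine (hui f a).abs.mono' (by fun_prop) (ae_of_all _ fun z => ?_)
        rw [Real.norm_eq_abs, abs_mul, abs_of_nonneg (mul_nonneg (hχ0 _) (hη0 _ _))]
        exact mul_le_of_le_one_left (abs_nonneg _) (mul_le_one₀ (hχ1 _) (hη0 _ _) (hηle _ _))
      have hlhs : ∑ j, ∑ a, ℓ j a * ∫ z, u a z ∂(μ j) =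
          ∫ z, ∑ j, ∑ a, ℓ j a * (χ z.1 * η j z.2 * u a z) ∂f.1 := by
        rw [integral_finsetSum _ fun j _ => integrable_finsetSum _ fun a _ =>
          (hint j a).const_mul _]
        refine Finset.sum_congr rfl fun j _ => ?_
        rw [integral_finsetSum _ fun a _ => (hint j a).const_mul _]
        refine Finset.sum_congr rfl fun a _ => ?_
        rw [integral_const_mul]
        congr 1
        exact withDensity_ofReal_integral f.1 (by fun_prop)
          (fun z => mul_nonneg (hχ0 _) (hη0 _ _)) (u a)
      calc ∑ j, ∑ a, ℓ j a * ∫ z, u a z ∂(μ j)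
          = ∫ z, ∑ j, ∑ a, ℓ j a * (χ z.1 * η j z.2 * u a z) ∂f.1 := hlhs
        _ ≤ ∫ z, φ z ∂f.1 := by
            refine integral_mono (integrable_finsetSum _ fun j _ => integrable_finsetSum _
              fun a _ => (hint j a).const_mul _) (integrable_of_growth hp f hφc hφK) fun z => ?_
            have h1 : ∀ j, ∑ a, ℓ j a * (χ z.1 * η j z.2 * u a z) =
                χ z.1 * (η j z.2 * ∑ a, ℓ j a * u a z) := fun j => by
              simp only [Finset.mul_sum]
              exact Finset.sum_congr rfl fun a _ => by ring
            simp only [h1, ← Finset.mul_sum]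
            refine mul_le_mul_of_nonneg_left ?_ (hχ0 _)
            refine (Finset.sum_le_sum fun j _ =>
              mul_le_mul_of_nonneg_left (hMge j z) (hη0 j z.2)).trans_eq ?_
            rw [← Finset.sum_mul, hη1, one_mul]
        _ ≤ ∫ z, φ z ∂g.1 := h φ hφc hφconv ⟨_, hφK⟩
        _ = ∫ z, M z ∂G := (withDensity_ofReal_integral g.1 (by fun_prop)
            (fun z => hχ0 _) M).symm
  have hνle : ∀ j, ν j ≤ G := fun j => by
    rw [← hν]
    exact Finset.single_le_sum (f := ν) (fun _ _ => Measure.zero_le _) (Finset.mem_univ j)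
  have hνf : ∀ j, IsFiniteMeasure (ν j) := fun j => isFiniteMeasure_of_le _ (hνle j)
  refine ⟨ν, hν, fun j => ⟨?_, ?_⟩⟩
  · have h1 := hνT j none
    simp only [hu, Option.elim, integral_const, smul_eq_mul, mul_one, measureReal_def] at h1
    exact (ENNReal.toReal_eq_toReal_iff' (measure_ne_top _ _) (measure_ne_top _ _)).1 h1
  · have hc : ∀ {κ : Measure (Phase d)}, Integrable (fun z : Phase d => z.2) κ →
        ∀ i, (∫ z, z.2 ∂κ) i = ∫ z, u (some i) z ∂κ := fun hκ i =>
      eval_integral_piLp (fun i => (hκ.eval_piLp i)) i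
    ext i
    rw [hc ((hvi g).mono_measure ((hνle j).trans hGle)) i,
      hc ((hvi f).mono_measure (hμle j)) i]
    exact hνT j (some i)

/-! ### Coupling by pieces and monotonicity of the relaxation -/

/-- The normalized product of two measures of equal mass `m` is a coupling of them. If `m = 0`, the
factor `m⁻¹ = ∞` multiplies the zero measure and the statement remains true. -/
lemma map_fst_inv_smul_prod {α β : Type*} [MeasurableSpace α] [MeasurableSpace β]
    (μ : Measure α) (ν : Measure β) [IsFiniteMeasure μ] [IsFiniteMeasure ν]
    (h : ν Set.univ = μ Set.univ) : ((μ Set.univ)⁻¹ • μ.prod ν).map Prod.fst = μ := by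
  rw [Measure.map_smul, Measure.map_fst_prod, h, smul_smul]
  by_cases h0 : μ Set.univ = 0
  · rw [Measure.measure_univ_eq_zero.1 h0, smul_zero]
  · rw [ENNReal.inv_mul_cancel h0 (measure_ne_top _ _), one_smul]

lemma map_snd_inv_smul_prod {α β : Type*} [MeasurableSpace α] [MeasurableSpace β]
    (μ : Measure α) (ν : Measure β) [IsFiniteMeasure μ] [IsFiniteMeasure ν]
    (h : ν Set.univ = μ Set.univ) : ((μ Set.univ)⁻¹ • μ.prod ν).map Prod.snd = ν := by
  rw [Measure.map_smul, Measure.map_snd_prod, smul_smul]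
  by_cases h0 : μ Set.univ = 0
  · rw [Measure.measure_univ_eq_zero.1 (h.trans h0), smul_zero]
  · rw [ENNReal.inv_mul_cancel h0 (measure_ne_top _ _), one_smul]

lemma map_sum_measure {α β I : Type*} [MeasurableSpace α] [MeasurableSpace β] [Fintype I]
    (Q : I → Measure α) {F : α → β} (hF : Measurable F) :
    (∑ i, Q i).map F = ∑ i, (Q i).map F := by
  ext s hs
  simp [Measure.map_apply hF hs, Measure.coe_finsetSum]

lemma sum_withDensity_ofReal {α I : Type*} [MeasurableSpace α] [Fintype I] (μ : Measure α)
    {w : I → α → ℝ} (hw : ∀ i, Measurable (w i)) (hw0 : ∀ i a, 0 ≤ w i a) :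
    ∑ i, μ.withDensity (fun a => ENNReal.ofReal (w i a)) =
      μ.withDensity fun a => ENNReal.ofReal (∑ i, w i a) := by
  ext s hs
  simp only [Measure.coe_finsetSum, Finset.sum_apply, withDensity_apply _ hs]
  rw [← lintegral_finsetSum _ fun i _ => (hw i).ennreal_ofReal]
  simp only [ENNReal.ofReal_sum_of_nonneg fun i (_ : i ∈ Finset.univ) => hw0 i _]

/-- By Jensen's inequality the mean is an almost optimal approximation by a constant. -/
lemma integral_norm_sub_average_rpow_le (hp : 1 ≤ p) {α : Type*} [MeasurableSpace α]
    {μ : Measure α} [IsFiniteMeasure μ] {F : α → Vec d} (hF : Measurable F)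
    (hFi : Integrable (fun a => ‖F a‖ ^ p) μ) (y : Vec d) :
    ∫ a, ‖F a - ⨍ b, F b ∂μ‖ ^ p ∂μ ≤ 2 ^ p * ∫ a, ‖F a - y‖ ^ p ∂μ := by
  rcases eq_zero_or_neZero μ with rfl | hμ
  · simp
  have hci : ∀ y : Vec d, Integrable (fun a => ‖F a - y‖ ^ p) μ := fun y =>
    integrable_rpow_sub hp hF measurable_const hFi (integrable_const _)
  set b := ⨍ b, F b ∂μ with hb
  have hconv : ConvexOn ℝ Set.univ fun v : Vec d => ‖v - y‖ ^ p := by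
    have := (convexOn_norm_rpow (d := d) hp).translate_left (-y)
    simpa [Function.comp_def, sub_eq_add_neg] using this
  have hJ : ‖b - y‖ ^ p ≤ ⨍ a, ‖F a - y‖ ^ p ∂μ :=
    hconv.map_average_le (f := F)
      (Continuous.continuousOn ((continuous_id.sub continuous_const).norm.rpow_const
        fun _ => Or.inr (by linarith)))
      isClosed_univ (by simp) (integrable_of_rpow hp hF.aestronglyMeasurable hFi) (hci y)
  have hm : 0 < μ.real Set.univ := by
    rw [measureReal_def]
    exact ENNReal.toReal_pos (NeZero.ne _) (measure_ne_top _ _)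
  rw [average_eq, smul_eq_mul, inv_mul_eq_div, le_div_iff₀ hm] at hJ
  calc ∫ a, ‖F a - b‖ ^ p ∂μ
      ≤ ∫ a, 2 ^ (p - 1) * (‖F a - y‖ ^ p + ‖b - y‖ ^ p) ∂μ := by
        refine integral_mono (hci b) (((hci y).add (integrable_const _)).const_mul _) fun a => ?_
        have := norm_sub_rpow_le hp (F a - y) (b - y)
        rwa [sub_sub_sub_cancel_right] at this
    _ = 2 ^ (p - 1) * (∫ a, ‖F a - y‖ ^ p ∂μ + ‖b - y‖ ^ p * μ.real Set.univ) := by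
        rw [integral_const_mul, integral_add (hci y) (integrable_const _), integral_const,
          smul_eq_mul, mul_comm (μ.real _)]
    _ ≤ 2 ^ (p - 1) * (2 * ∫ a, ‖F a - y‖ ^ p ∂μ) := by
        refine mul_le_mul_of_nonneg_left ?_ (by positivity)
        linarith
    _ = 2 ^ p * ∫ a, ‖F a - y‖ ^ p ∂μ := by
        rw [← mul_assoc, Real.rpow_sub_one (by norm_num)]
        norm_num

/-- Let `f` and `g` be split into pieces `μ i = w i f` and `ν i` with equal masses and equal mean
velocities `b i`. Coupling the pieces independently gives a coupling of `f` and `g` under which `v'`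
has conditional expectation `∑ i, w i (x, v) • b i` given `(x, v)`. It is close to `v` if the
velocities in each piece are concentrated near some point `y i`. -/
lemma exists_coupling_of_decomposition (hp : 1 ≤ p) (f g : PP d p) {I : Type*} [Fintype I]
    {w : I → Phase d → ℝ} (hwm : ∀ i, Measurable (w i)) (hw0 : ∀ i z, 0 ≤ w i z)
    (hw1 : ∀ z, ∑ i, w i z = 1) {μ ν : I → Measure (Phase d)}
    (hμ : ∀ i, μ i = f.1.withDensity fun z => ENNReal.ofReal (w i z)) (hν : ∑ i, ν i = g.1)
    (hmass : ∀ i, ν i Set.univ = μ i Set.univ)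
    (hmean : ∀ i, ∫ z, z.2 ∂(ν i) = ∫ z, z.2 ∂(μ i)) (x y : I → Vec d) :
    ∃ (P : Measure (Phase d × Phase d)) (s : Phase d × Phase d → Vec d),
      P.map Prod.fst = f.1 ∧ P.map Prod.snd = g.1 ∧ Measurable s ∧
      Integrable (fun q => ‖s q‖ ^ p) P ∧
      (∀ A, MeasurableSet A → ∫ q in Prod.fst ⁻¹' A, (q.2.2 + s q - q.1.2) ∂P = 0) ∧
      ∫ q, (‖q.1.1 - q.2.1‖ ^ p + ‖s q‖ ^ p) ∂P ≤
        2 ^ (p - 1) * ∑ i, (∫ z, ‖z.1 - x i‖ ^ p ∂(μ i) + ∫ z, ‖z.1 - x i‖ ^ p ∂(ν i)) +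
          2 ^ p * ∑ i, ∫ z, ‖z.2 - y i‖ ^ p ∂(μ i) := by
  have hwle : ∀ i z, w i z ≤ 1 := fun i z => by
    rw [← hw1 z]
    exact Finset.single_le_sum (fun i _ => hw0 i z) (Finset.mem_univ i)
  have hμle : ∀ i, μ i ≤ f.1 := fun i => by
    rw [hμ i]
    exact withDensity_ofReal_le _ (hwle i)
  have hνle : ∀ i, ν i ≤ g.1 := fun i => by
    rw [← hν]
    exact Finset.single_le_sum (f := ν) (fun _ _ => Measure.zero_le _) (Finset.mem_univ i)
  have hμf : ∀ i, IsFiniteMeasure (μ i) := fun i => isFiniteMeasure_of_le _ (hμle i)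
  have hνf : ∀ i, IsFiniteMeasure (ν i) := fun i => isFiniteMeasure_of_le _ (hνle i)
  have hμint : ∀ i (F : Phase d → ℝ), ∫ z, F z ∂(μ i) = ∫ z, w i z * F z ∂f.1 := fun i F => by
    rw [hμ i, withDensity_ofReal_integral f.1 (hwm i) (hw0 i)]
    simp only [smul_eq_mul]
  have hμsum : ∑ i, μ i = f.1 := by
    simp only [hμ]
    rw [sum_withDensity_ofReal f.1 hwm hw0]
    simp only [hw1, ENNReal.ofReal_one]
    exact withDensity_one
  set Q : I → Measure (Phase d × Phase d) := fun i => (μ i Set.univ)⁻¹ • (μ i).prod (ν i) with hQ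
  have hQ1 : ∀ i, (Q i).map Prod.fst = μ i := fun i => map_fst_inv_smul_prod _ _ (hmass i)
  have hQ2 : ∀ i, (Q i).map Prod.snd = ν i := fun i => map_snd_inv_smul_prod _ _ (hmass i)
  set P := ∑ i, Q i with hP
  have hP1 : P.map Prod.fst = f.1 := by
    rw [hP, map_sum_measure _ measurable_fst]
    simp only [hQ1, hμsum]
  have hP2 : P.map Prod.snd = g.1 := by
    rw [hP, map_sum_measure _ measurable_snd]
    simp only [hQ2, hν]
  have hPprob : IsProbabilityMeasure P := isProbabilityMeasure_of_map_eq measurable_fst hP1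
  have hQle : ∀ i, Q i ≤ P := fun i =>
    Finset.single_le_sum (f := Q) (fun _ _ => Measure.zero_le _) (Finset.mem_univ i)
  set b : I → Vec d := fun i => ⨍ z, z.2 ∂(μ i) with hb
  set B : Phase d → Vec d := fun z => ∑ i, w i z • b i with hB
  have hBm : Measurable B := by fun_prop
  have hBle : ∀ z, ‖B z‖ ≤ ∑ i, ‖b i‖ := fun z => by
    refine (norm_sum_le _ _).trans (Finset.sum_le_sum fun i _ => ?_)
    rw [norm_smul, Real.norm_of_nonneg (hw0 i z)]
    exact mul_le_of_le_one_left (norm_nonneg _) (hwle i z)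
  have hBi : Integrable B f.1 :=
    (integrable_const (∑ i, ‖b i‖)).mono' hBm.aestronglyMeasurable (ae_of_all _ hBle)
  have hBpm : Measurable fun z => ‖B z‖ ^ p := by fun_prop
  have hBp : Integrable (fun z => ‖B z‖ ^ p) f.1 := by
    refine (integrable_const ((∑ i, ‖b i‖) ^ p)).mono' hBpm.aestronglyMeasurable
      (ae_of_all _ fun z => ?_)
    rw [Real.norm_of_nonneg (by positivity)]
    exact Real.rpow_le_rpow (norm_nonneg _) (hBle z) (by linarith)
  have hvB : Integrable (fun z : Phase d => ‖z.2 - B z‖ ^ p) f.1 :=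
    integrable_rpow_sub hp measurable_snd hBm f.integrable_snd hBp
  have hvBm : Measurable fun z : Phase d => ‖z.2 - B z‖ ^ p := by fun_prop
  have hsP : Integrable (fun q : Phase d × Phase d => ‖q.1.2 - B q.1‖ ^ p) P := by
    rw [← hP1, integrable_map_measure hvBm.aestronglyMeasurable (by fun_prop)] at hvB
    exact hvB
  have hxcost : Integrable (fun q : Phase d × Phase d => ‖q.1.1 - q.2.1‖ ^ p) P :=
    integrable_rpow_sub hp (by fun_prop) (by fun_prop)
      (integrable_fst_of_law (f := f) measurable_fst hP1.symm)
      (integrable_fst_of_law (f := g) measurable_snd hP2.symm)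
  refine ⟨P, fun q => q.1.2 - B q.1, hP1, hP2, by fun_prop, hsP, fun A hA => ?_, ?_⟩
  · have hv' : Integrable (fun q : Phase d × Phase d => q.2.2) P :=
      integrable_of_rpow hp (by fun_prop)
        (integrable_snd_of_law (f := g) measurable_snd hP2.symm)
    have hBP : Integrable (fun q : Phase d × Phase d => B q.1) P := by
      rw [← hP1, integrable_map_measure hBm.aestronglyMeasurable (by fun_prop)] at hBi
      exact hBi
    have e1 : ∀ q : Phase d × Phase d, q.2.2 + (q.1.2 - B q.1) - q.1.2 = q.2.2 - B q.1 :=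
      fun q => by abel
    simp only [e1]
    rw [integral_sub hv'.integrableOn hBP.integrableOn, sub_eq_zero]
    have hAm : MeasurableSet (Prod.fst ⁻¹' A : Set (Phase d × Phase d)) := measurable_fst hA
    have h1 : ∫ q in Prod.fst ⁻¹' A, q.2.2 ∂P = ∑ i, (μ i).real A • b i := by
      rw [← integral_indicator hAm, hP, integral_finsetSum_measure fun i _ =>
        (hv'.indicator hAm).mono_measure (hQle i)]
      refine Finset.sum_congr rfl fun i _ => ?_
      rw [integral_indicator hAm, hQ, Measure.restrict_smul, integral_smul_measure,
        ← Set.prod_univ, ← Measure.prod_restrict, Measure.restrict_univ]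
      rw [integral_fun_snd (μ := (μ i).restrict A) (ν := ν i) (fun z : Phase d => z.2), hmean i,
        show b i = _ from average_eq _ _, smul_comm, ENNReal.toReal_inv]
      simp [measureReal_def]
    have h2 : ∫ q in Prod.fst ⁻¹' A, B q.1 ∂P = ∑ i, (μ i).real A • b i := by
      rw [← setIntegral_map hA (by rw [hP1]; exact hBm.aestronglyMeasurable) (by fun_prop), hP1]
      have hwi : ∀ i, Integrable (w i) f.1 := fun i =>
        (integrable_const (1 : ℝ)).mono' (hwm i).aestronglyMeasurable (ae_of_all _ fun z => by
          rw [Real.norm_of_nonneg (hw0 i z)]; exact hwle i z)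
      rw [hB, integral_finsetSum _ fun i _ => ((hwi i).smul_const (b i)).integrableOn]
      refine Finset.sum_congr rfl fun i _ => ?_
      rw [integral_smul_const]
      congr 1
      rw [hμ i, measureReal_def, withDensity_apply _ hA,
        ← ofReal_integral_eq_lintegral_ofReal (hwi i).integrableOn (ae_of_all _ (hw0 i)),
        ENNReal.toReal_ofReal (integral_nonneg (hw0 i))]
    rw [h1, h2]
  · rw [integral_add hxcost hsP]
    have hxi : ∀ i, Integrable (fun z : Phase d => ‖z.1 - x i‖ ^ p) (μ i) := fun i =>
      integrable_rpow_sub hp (by fun_prop) measurable_const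
        (f.integrable_fst.mono_measure (hμle i)) (integrable_const _)
    have hxi' : ∀ i, Integrable (fun z : Phase d => ‖z.1 - x i‖ ^ p) (ν i) := fun i =>
      integrable_rpow_sub hp (by fun_prop) measurable_const
        (g.integrable_fst.mono_measure (hνle i)) (integrable_const _)
    have hxm : ∀ i, Measurable fun z : Phase d => ‖z.1 - x i‖ ^ p := fun i => by fun_prop
    refine add_le_add ?_ ?_
    · rw [integral_finsetSum_measure fun i _ => hxcost.mono_measure (hQle i), Finset.mul_sum]
      refine Finset.sum_le_sum fun i _ => ?_
      have i1 : Integrable (fun q : Phase d × Phase d => ‖q.1.1 - x i‖ ^ p) (Q i) := by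
        have h1 := hxi i
        rw [← hQ1 i, integrable_map_measure (hxm i).aestronglyMeasurable (by fun_prop)] at h1
        exact h1
      have i2 : Integrable (fun q : Phase d × Phase d => ‖q.2.1 - x i‖ ^ p) (Q i) := by
        have h1 := hxi' i
        rw [← hQ2 i, integrable_map_measure (hxm i).aestronglyMeasurable (by fun_prop)] at h1
        exact h1
      have e1 : ∫ z, ‖z.1 - x i‖ ^ p ∂(μ i) = ∫ q, ‖q.1.1 - x i‖ ^ p ∂(Q i) := by
        rw [← hQ1 i, integral_map (by fun_prop) (hxm i).aestronglyMeasurable]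
      have e2 : ∫ z, ‖z.1 - x i‖ ^ p ∂(ν i) = ∫ q, ‖q.2.1 - x i‖ ^ p ∂(Q i) := by
        rw [← hQ2 i, integral_map (by fun_prop) (hxm i).aestronglyMeasurable]
      rw [e1, e2, ← integral_add i1 i2, ← integral_const_mul]
      refine integral_mono (hxcost.mono_measure (hQle i)) ((i1.add i2).const_mul _) fun q => ?_
      have := norm_sub_rpow_le hp (q.1.1 - x i) (q.2.1 - x i)
      rwa [sub_sub_sub_cancel_right] at this
    · have hvi : ∀ i, Integrable (fun z : Phase d => w i z * ‖z.2 - b i‖ ^ p) f.1 := fun i => by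
        have h1 : Integrable (fun z : Phase d => ‖z.2 - b i‖ ^ p) f.1 :=
          integrable_rpow_sub hp measurable_snd measurable_const f.integrable_snd
            (integrable_const _)
        have hm : Measurable fun z : Phase d => w i z * ‖z.2 - b i‖ ^ p := by
          have := hwm i
          fun_prop
        refine h1.mono' hm.aestronglyMeasurable (ae_of_all _ fun z => ?_)
        rw [Real.norm_of_nonneg (mul_nonneg (hw0 i z) (by positivity))]
        exact mul_le_of_le_one_left (by positivity) (hwle i z)
      have e1 : ∫ q, ‖q.1.2 - B q.1‖ ^ p ∂P = ∫ z, ‖z.2 - B z‖ ^ p ∂f.1 := by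
        rw [← hP1, integral_map (by fun_prop) hvBm.aestronglyMeasurable]
      calc ∫ q, ‖q.1.2 - B q.1‖ ^ p ∂P
          = ∫ z, ‖z.2 - B z‖ ^ p ∂f.1 := e1
        _ ≤ ∫ z, ∑ i, w i z * ‖z.2 - b i‖ ^ p ∂f.1 := by
            refine integral_mono hvB (integrable_finsetSum _ fun i _ => hvi i) fun z => ?_
            have h1 := (convexOn_norm_rpow (d := d) hp).map_sum_le (t := Finset.univ)
              (w := fun i => w i z) (p := fun i => z.2 - b i) (fun i _ => hw0 i z) (hw1 z)
              fun i _ => Set.mem_univ _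
            have h2 : z.2 - B z = ∑ i, w i z • (z.2 - b i) := by
              simp only [smul_sub, Finset.sum_sub_distrib, ← Finset.sum_smul, hw1, one_smul, hB]
            simp only [h2]
            simpa only [smul_eq_mul] using h1
        _ = ∑ i, ∫ z, ‖z.2 - b i‖ ^ p ∂(μ i) := by
            rw [integral_finsetSum _ fun i _ => hvi i]
            exact Finset.sum_congr rfl fun i _ => (hμint i _).symm
        _ ≤ 2 ^ p * ∑ i, ∫ z, ‖z.2 - y i‖ ^ p ∂(μ i) := by
            rw [Finset.mul_sum]
            exact Finset.sum_le_sum fun i _ => integral_norm_sub_average_rpow_le hp measurable_snd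
              (f.integrable_snd.mono_measure (hμle i)) (y i)

open Filter Topology in
lemma tendsto_integral_tail {α : Type*} [MeasurableSpace α] {μ : Measure α} {F : α → Vec d}
    (hF : Measurable F) (hFi : Integrable (fun a => ‖F a‖ ^ p) μ) :
    Tendsto (fun n : ℕ => ∫ a, {x : Vec d | (n : ℝ) < ‖x‖}.indicator (‖·‖ ^ p) (F a) ∂μ) atTop
      (𝓝 0) := by
  have hm : ∀ n : ℕ, Measurable fun a =>
      {x : Vec d | (n : ℝ) < ‖x‖}.indicator (‖·‖ ^ p) (F a) := fun n => by
    have h1 : Measurable fun x : Vec d => ‖x‖ ^ p := by fun_prop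
    exact (h1.indicator (measurableSet_lt measurable_const measurable_norm)).comp hF
  have := tendsto_integral_of_dominated_convergence (F := fun (n : ℕ) a =>
    {x : Vec d | (n : ℝ) < ‖x‖}.indicator (‖·‖ ^ p) (F a)) (f := fun _ => (0 : ℝ)) _
    (fun n => (hm n).aestronglyMeasurable) hFi
    (fun n => ae_of_all _ fun a => ?_) (ae_of_all _ fun a => ?_)
  · simpa using this
  · rw [Real.norm_of_nonneg (Set.indicator_nonneg (fun _ _ => by positivity) _)]
    exact Set.indicator_le_self' (fun _ _ => by positivity) _
  · refine tendsto_const_nhds.congr' ?_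
    filter_upwards [eventually_ge_atTop ⌈‖F a‖⌉₊] with n hn
    have : F a ∉ {x : Vec d | (n : ℝ) < ‖x‖} := not_lt.2 (Nat.ceil_le.1 hn)
    exact (Set.indicator_of_notMem this _).symm

lemma sum_integral_le_of_partition_of_unity (hp : 1 ≤ p) {α ι : Type*} [MeasurableSpace α]
    {μ : Measure α} [IsProbabilityMeasure μ] [Fintype ι] {χ : ι → Vec d → ℝ} {y : ι → Vec d}
    {δ R : ℝ} (hχc : ∀ k, Continuous (χ k)) (hχ0 : ∀ k x, 0 ≤ χ k x) (hχ1 : ∀ x, ∑ k, χ k x = 1)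
    (hχ : ∀ x, ∑ k, χ k x * ‖x - y k‖ ^ p ≤ δ + {x : Vec d | R < ‖x‖}.indicator (‖·‖ ^ p) x)
    {F : α → Vec d} (hF : Measurable F) (hFi : Integrable (fun a => ‖F a‖ ^ p) μ) :
    ∑ k, ∫ a, χ k (F a) * ‖F a - y k‖ ^ p ∂μ ≤
      δ + ∫ a, {x : Vec d | R < ‖x‖}.indicator (‖·‖ ^ p) (F a) ∂μ := by
  have hi : ∀ k, Integrable (fun a => χ k (F a) * ‖F a - y k‖ ^ p) μ := fun k => by
    have hm : Measurable fun a => χ k (F a) * ‖F a - y k‖ ^ p := by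
      have := (hχc k).measurable.comp hF
      fun_prop
    refine (integrable_rpow_sub hp hF measurable_const hFi
      (integrable_const (‖y k‖ ^ p))).mono' hm.aestronglyMeasurable (ae_of_all _ fun a => ?_)
    rw [Real.norm_of_nonneg (mul_nonneg (hχ0 _ _) (by positivity))]
    refine mul_le_of_le_one_left (by positivity) ?_
    rw [← hχ1 (F a)]
    exact Finset.single_le_sum (fun k _ => hχ0 k (F a)) (Finset.mem_univ k)
  have hti : Integrable (fun a => {x : Vec d | R < ‖x‖}.indicator (‖·‖ ^ p) (F a)) μ := by
    have h1 : Measurable fun x : Vec d => ‖x‖ ^ p := by fun_prop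
    refine hFi.mono' ((h1.indicator (measurableSet_lt measurable_const
      measurable_norm)).comp hF).aestronglyMeasurable (ae_of_all _ fun a => ?_)
    rw [Real.norm_of_nonneg (Set.indicator_nonneg (fun _ _ => by positivity) _)]
    exact Set.indicator_le_self' (fun _ _ => by positivity) _
  rw [← integral_finsetSum _ fun k _ => hi k]
  refine (integral_mono (integrable_finsetSum _ fun k _ => hi k)
    ((integrable_const δ).add hti) fun a => hχ (F a)).trans_eq ?_
  rw [integral_add' (integrable_const δ) hti]
  simp only [integral_const, probReal_univ, one_smul]

/-- An approximate form of Strassen's theorem: measures in velocity-convex order have couplings that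
are almost martingales in `v` and almost leave `x` unchanged. -/
lemma VConvexLE.exists_coupling (hp : 1 ≤ p) {f g : PP d p} (h : VConvexLE f g) {ε : ℝ}
    (hε : 0 < ε) :
    ∃ (P : Measure (Phase d × Phase d)) (s : Phase d × Phase d → Vec d),
      P.map Prod.fst = f.1 ∧ P.map Prod.snd = g.1 ∧ Measurable s ∧
      Integrable (fun q => ‖s q‖ ^ p) P ∧
      (∀ A, MeasurableSet A → ∫ q in Prod.fst ⁻¹' A, (q.2.2 + s q - q.1.2) ∂P = 0) ∧
      ∫ q, (‖q.1.1 - q.2.1‖ ^ p + ‖s q‖ ^ p) ∂P ≤ ε := by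
  set δ : ℝ := ε / (4 * 2 ^ p) with hδ
  have hδ0 : 0 < δ := by positivity
  obtain ⟨n, ⟨h1, h2⟩, h3⟩ := (((tendsto_integral_tail measurable_fst
    f.integrable_fst).eventually_lt_const hδ0).and ((tendsto_integral_tail measurable_fst
    g.integrable_fst).eventually_lt_const hδ0) |>.and ((tendsto_integral_tail measurable_snd
    f.integrable_snd).eventually_lt_const hδ0)).exists
  obtain ⟨ι, _, χ, y, hχc, hχ0, hχ1, hχ⟩ := exists_partition_of_unity d hp hδ0 (n : ℝ)
  have : Nonempty ι := by
    by_contra hne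
    rw [not_nonempty_iff] at hne
    simpa using hχ1 0
  have hχle : ∀ k x, χ k x ≤ 1 := fun k x => by
    rw [← hχ1 x]
    exact Finset.single_le_sum (fun k _ => hχ0 k x) (Finset.mem_univ k)
  choose ν hνsum hν using fun k => h.exists_decomposition hp (hχc k) (hχ0 k) (hχle k) hχc hχ0 hχ1
  set μ : ι × ι → Measure (Phase d) := fun i =>
    f.1.withDensity fun z => ENNReal.ofReal (χ i.1 z.1 * χ i.2 z.2) with hμ
  have hwm : ∀ i : ι × ι, Measurable fun z : Phase d => χ i.1 z.1 * χ i.2 z.2 := fun i =>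
    (((hχc i.1).comp continuous_fst).mul ((hχc i.2).comp continuous_snd)).measurable
  have hw0 : ∀ (i : ι × ι) (z : Phase d), 0 ≤ χ i.1 z.1 * χ i.2 z.2 := fun i z =>
    mul_nonneg (hχ0 _ _) (hχ0 _ _)
  have hχm : ∀ k, Measurable fun z : Phase d => χ k z.1 := fun k =>
    ((hχc k).comp continuous_fst).measurable
  have hν1 : ∑ i : ι × ι, ν i.1 i.2 = g.1 := by
    rw [Fintype.sum_prod_type]
    simp only [hνsum]
    rw [sum_withDensity_ofReal g.1 hχm fun k z => hχ0 k z.1]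
    simp only [hχ1, ENNReal.ofReal_one]
    exact withDensity_one
  obtain ⟨P, s, hP1, hP2, hs, hsi, hm, hcost⟩ := exists_coupling_of_decomposition hp f g
    (w := fun (i : ι × ι) z => χ i.1 z.1 * χ i.2 z.2) hwm hw0
    (fun z => by
      rw [Fintype.sum_prod_type]
      simp only [← Finset.mul_sum, hχ1, mul_one])
    (μ := μ) (ν := fun i => ν i.1 i.2) (fun i => rfl) hν1 (fun i => (hν i.1 i.2).1)
    (fun i => (hν i.1 i.2).2) (fun i => y i.1) (fun i => y i.2)
  refine ⟨P, s, hP1, hP2, hs, hsi, hm, hcost.trans ?_⟩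
  -- each of the three sums is the integral of `∑ k, χ k * ‖· - y k‖ ^ p`
  have hci : ∀ (f : PP d p) (F : Phase d → Vec d), Measurable F →
      Integrable (fun z => ‖F z‖ ^ p) f.1 → ∀ k, Integrable (fun z => ‖F z - y k‖ ^ p) f.1 :=
    fun f F hF hFi k => integrable_rpow_sub hp hF measurable_const hFi (integrable_const _)
  have hbound : ∀ (f : PP d p) (F : Phase d → Vec d), Measurable F →
      Integrable (fun z => ‖F z‖ ^ p) f.1 →
      ∫ z, {x : Vec d | (n : ℝ) < ‖x‖}.indicator (‖·‖ ^ p) (F z) ∂f.1 < δ →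
      ∑ k, ∫ z, χ k (F z) * ‖F z - y k‖ ^ p ∂f.1 ≤ 2 * δ := fun f F hF hFi htail =>
    (sum_integral_le_of_partition_of_unity hp hχc hχ0 hχ1 hχ hF hFi).trans (by linarith)
  have hμint : ∀ (i : ι × ι) (F : Phase d → ℝ), ∫ z, F z ∂(μ i) =
      ∫ z, χ i.1 z.1 * χ i.2 z.2 * F z ∂f.1 := fun i F =>
    withDensity_ofReal_integral f.1 (hwm i) (hw0 i) F
  have hprod : ∀ (i : ι × ι) (F : Phase d → ℝ), Measurable F → (∀ z, 0 ≤ F z) →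
      Integrable F f.1 → Integrable (fun z => χ i.1 z.1 * χ i.2 z.2 * F z) f.1 :=
    fun i F hF hF0 hFi => by
      refine hFi.mono' ((hwm i).mul hF).aestronglyMeasurable (ae_of_all _ fun z => ?_)
      rw [Real.norm_of_nonneg (mul_nonneg (hw0 i z) (hF0 z))]
      exact mul_le_of_le_one_left (hF0 z) (mul_le_one₀ (hχle _ _) (hχ0 _ _) (hχle _ _))
  have b1 : ∑ i : ι × ι, ∫ z, ‖z.1 - y i.1‖ ^ p ∂(μ i) ≤ 2 * δ := by
    refine le_trans (le_of_eq ?_) (hbound f Prod.fst measurable_fst f.integrable_fst h1)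
    rw [Fintype.sum_prod_type]
    refine Finset.sum_congr rfl fun k _ => ?_
    simp only [hμint]
    rw [← integral_finsetSum _ fun j _ => hprod (k, j) (fun z => ‖z.1 - y k‖ ^ p) (by fun_prop)
      (fun z => by positivity) (hci f Prod.fst measurable_fst f.integrable_fst k)]
    simp only [← Finset.sum_mul, ← Finset.mul_sum, hχ1, mul_one]
  have b2 : ∑ i : ι × ι, ∫ z, ‖z.1 - y i.1‖ ^ p ∂(ν i.1 i.2) ≤ 2 * δ := by
    refine le_trans (le_of_eq ?_) (hbound g Prod.fst measurable_fst g.integrable_fst h2)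
    rw [Fintype.sum_prod_type]
    refine Finset.sum_congr rfl fun k _ => ?_
    have hle : ∀ j, ν k j ≤ g.1 := fun j => by
      refine le_trans ?_ (withDensity_ofReal_le g.1 fun z => hχle k z.1)
      rw [← hνsum k]
      exact Finset.single_le_sum (f := ν k) (fun _ _ => Measure.zero_le _) (Finset.mem_univ j)
    rw [← integral_finsetSum_measure fun j _ =>
      (hci g Prod.fst measurable_fst g.integrable_fst k).mono_measure (hle j), hνsum k]
    exact withDensity_ofReal_integral g.1 (hχm k) (fun z => hχ0 k z.1) _
  have b3 : ∑ i : ι × ι, ∫ z, ‖z.2 - y i.2‖ ^ p ∂(μ i) ≤ 2 * δ := by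
    refine le_trans (le_of_eq ?_) (hbound f Prod.snd measurable_snd f.integrable_snd h3)
    rw [Fintype.sum_prod_type_right]
    refine Finset.sum_congr rfl fun j _ => ?_
    simp only [hμint]
    rw [← integral_finsetSum _ fun k _ => hprod (k, j) (fun z => ‖z.2 - y j‖ ^ p) (by fun_prop)
      (fun z => by positivity) (hci f Prod.snd measurable_snd f.integrable_snd j)]
    simp only [← Finset.sum_mul, hχ1, one_mul]
  rw [Finset.sum_add_distrib]
  have h2p : (2 : ℝ) ^ (p - 1) * 2 = 2 ^ p := by
    rw [Real.rpow_sub_one (by norm_num)]; norm_num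
  calc 2 ^ (p - 1) * (∑ i : ι × ι, ∫ z, ‖z.1 - y i.1‖ ^ p ∂(μ i) +
        ∑ i : ι × ι, ∫ z, ‖z.1 - y i.1‖ ^ p ∂(ν i.1 i.2)) +
        2 ^ p * ∑ i : ι × ι, ∫ z, ‖z.2 - y i.2‖ ^ p ∂(μ i)
      ≤ 2 ^ (p - 1) * (2 * δ + 2 * δ) + 2 ^ p * (2 * δ) := by gcongr
    _ = 2 ^ p * (4 * δ) := by rw [← h2p]; ring
    _ = ε := by rw [hδ]; field_simp

lemma increasing_rel (hp : 1 < p) {c C : ℝ} (hc : 0 < c) (hC : 0 < C)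
    {Φ : PP d p → ℝ} (hG : Growth c C Φ) (hW : WpEstimate C Φ) : Increasing (rel Φ) := by
  intro f g h
  have hp0 : 0 < p := by linarith
  have hσ : 0 ≤ (p - 1) / p := div_nonneg (by linarith) hp0.le
  have hK : 0 < shiftConst p c C := by unfold shiftConst; positivity
  have hg := mom_nonneg g
  refine le_of_forall_pos_le_add fun ε hε => ?_
  set Q := (shiftConst p c C * (3 + mom g)) ^ ((p - 1) / p) with hQ
  have hQ0 : 0 < Q := by positivity
  obtain ⟨P, s, hP1, hP2, hs, hsi, hm, hcost⟩ := h.exists_coupling hp.le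
    (ε := min 1 ((ε / Q) ^ p)) (lt_min one_pos (by positivity))
  have hxi : Integrable (fun q : Phase d × Phase d => ‖q.1.1 - q.2.1‖ ^ p) P :=
    integrable_rpow_sub hp.le (by fun_prop) (by fun_prop)
      (integrable_fst_of_law (f := f) measurable_fst hP1.symm)
      (integrable_fst_of_law (f := g) measurable_snd hP2.symm)
  have he0 : 0 ≤ ∫ q, (‖q.1.1 - q.2.1‖ ^ p + ‖s q‖ ^ p) ∂P :=
    integral_nonneg fun q => by positivity
  have hS0 : 0 ≤ ∫ q, ‖s q‖ ^ p ∂P := integral_nonneg fun q => by positivity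
  have hS : ∫ q, ‖s q‖ ^ p ∂P ≤ 1 := by
    refine le_trans (integral_mono hsi (hxi.add hsi) fun q => ?_)
      (hcost.trans (min_le_left _ _))
    exact le_add_of_nonneg_left (by positivity)
  have h1 : (∫ q, (‖q.1.1 - q.2.1‖ ^ p + ‖s q‖ ^ p) ∂P) ^ (1 / p) ≤ ε / Q := by
    have h2 := Real.rpow_le_rpow he0 (hcost.trans (min_le_right _ _)) (by positivity : 0 ≤ 1 / p)
    rwa [← Real.rpow_mul (by positivity), mul_one_div_cancel hp0.ne', Real.rpow_one] at h2
  have h3 : (shiftConst p c C * (2 + mom g + ∫ q, ‖s q‖ ^ p ∂P)) ^ ((p - 1) / p) ≤ Q := by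
    refine Real.rpow_le_rpow (by positivity) (mul_le_mul_of_nonneg_left ?_ hK.le) hσ
    linarith
  refine (rel_le_rel_add_of_shift hp hc hC hG hW f g hP1 hP2 hs hsi hm).trans
    (add_le_add_right ?_ _)
  calc _ ≤ Q * (ε / Q) := mul_le_mul h3 h1 (Real.rpow_nonneg he0 _) hQ0.le
    _ = ε := by field_simp

lemma rel_le_inc (hp : 1 < p) {c C : ℝ} (hc : 0 < c) (hC : 0 < C)
    {Φ : PP d p → ℝ} (hG : Growth c C Φ) (hW : WpEstimate C Φ) (f : PP d p) :
    rel Φ f ≤ inc Φ f :=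
  le_inc fun g hg => (increasing_rel hp hc hC hG hW f g hg).trans (rel_le_self hc.le hG g)

end RelaxedAction

theorem mainTheorem9 (d : ℕ) (p c C : ℝ) (hp : 1 < p) (hc : 0 < c) (hC : 0 < C) :
    ∃ C' : ℝ, c < C' ∧ C ≤ C' ∧
      ∀ Φ : PP d p → ℝ, Growth c C Φ → WpEstimate C Φ →
        (Growth c C (rel Φ) ∧ Growth c C' (rel Φ)) ∧
        (WpContinuous (rel Φ) ∧ WpEstimate C' (rel Φ)) ∧
        Increasing (rel Φ) ∧
        (∀ f, inc (conv Φ) f ≤ conv (inc Φ) f) ∧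
        (∀ f, inc (conv Φ) f ≤ rel Φ f ∧ rel Φ f ≤ inc Φ f) ∧
        (IsConvex Φ → rel Φ = inc Φ ∧ IsConvex (rel Φ)) := by
  have hK : 0 < shiftConst p c C * (1 + 2 ^ (p - 1)) := by unfold shiftConst; positivity
  have hcC : c < relConst p c C := by unfold relConst; linarith
  have hCC : C ≤ relConst p c C := by unfold relConst; linarith
  refine ⟨relConst p c C, hcC, hCC, fun Φ hG hW => ?_⟩
  have hlow : ∀ g, pairing g (-C) c ≤ Φ g := fun g => (hG g).1
  have hrel := growth_rel hp.le hc.le hG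
  have hest := wpEstimate_rel hp hc hC hG hW
  have hle : ∀ f, inc (conv Φ) f ≤ rel Φ f ∧ rel Φ f ≤ inc Φ f := fun f =>
    ⟨inc_conv_le_rel hp.le hc.le hlow f, rel_le_inc hp hc hC hG hW f⟩
  refine ⟨⟨hrel, hrel.mono hCC⟩, ⟨hest.wpContinuous hp (hC.trans_le hCC), hest⟩,
    increasing_rel hp hc hC hG hW, inc_conv_le_conv_inc hp.le hc.le hlow, hle, fun hconv => ?_⟩
  have heq : rel Φ = inc Φ := funext fun f => le_antisymm (hle f).2 (by
    have := (hle f).1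
    rwa [hconv.conv_eq hlow] at this)
  exact ⟨heq, heq ▸ isConvex_inc hp.le (neg_le_of_lower hc.le hlow) hconv⟩
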